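/- Let $n\in\{2,3\}$ and let $\Omega\subset\mathbb{R}^n$ be a bounded domain (nonempty, open, connected) with smooth boundary. Let $\Omega^k(\Omega)$ be the space of $k$-forms that are smooth up to the boundary, and let $\mathrm{SVect}(\Omega)$ be the space of vector fields that are smooth up to the boundary, divergence free and tangent to $\partial\Omega$, all with the $C^\infty$ topology (uniform convergence of all derivatives on $\overline\Omega$). Let $\mathrm{SVect}^*(\Omega)=\Omega^1(\Omega)/d\Omega^0(\Omega)$ be the regular dual, with the quotient topology, where the class $[\alpha]$ represents the functional $u\mapsto\int_\Omega\alpha(u)\,dV$ on $\mathrm{SVect}(\Omega)$; write $\omega=d\alpha$. Let $\mathcal A$ be the set of smooth functionals $F:\mathrm{SVect}^*(\Omega)\to\mathbb{R}$ that have a smooth $L^2$ gradient in $\mathrm{SVect}(\Omega)$, i.e. a smooth map $\delta F:\mathrm{SVect}^*(\Omega)\to \mathrm{SVect}(\Omega)$ with $$D_{[\delta\alpha]}F(m)=\left.\frac{d}{d\varepsilon}\right|_{\varepsilon=0}F(m+\varepsilon[\delta\alpha])=\int_\Omega \delta\alpha\big(\delta F(m)\big)\,dV\qquad\text{for all } m\in\mathrm{SVect}^*(\Omega),\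 \delta\alpha\in\Omega^1(\Omega).$$ (Smooth maps are those of the usual differential calculus in Fréchet spaces: the iterated directional derivatives exist and are jointly continuous.) The gradient $\delta F$ is then unique. For $F,G\in\mathcal A$ define Arnold's bracket by $$\{F,G\}([\alpha])=\int_\Omega\omega(\delta F,\delta G)\,dV .$$ Then: 1. $\{F,G\}([\alpha])=-\int_\Omega\alpha([\delta F,\delta G])\,dV$ for all $F,G\in\mathcal A$ and $\alpha\in\Omega^1(\Omega)$, where $[u,v]=D_uv-D_vu$. 2. $\{\cdot,\cdot\}$ is a Hamiltonian structure on $\mathcal A$: $\mathcal A$ is a real vector space, the bracket is bilinear on $\mathcal A$, and for all $F,G,H\in\mathcal A$ one has $\{F,G\}\in\mathcal A$, $\{G,F\}=-\{F,G\}$ and $$\{\{F,G\},H\}+\{\{G,H\},F\}+\{\{H,F\},G\}=0 .$$ 3. For all $F,G\in\mathcal A$ the gradient of $\{F,G\}$ is $$\delta\{F,G\}=D_{[i_{\delta F}\omega]}\,\delta G-D_{[i_{\delta G}\omega]}\,\delta F-[\delta F,\delta G],$$ where $i_u\omega=\omega(u,\cdot)$ and $D_{[\beta]}$ is the directional derivative,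 which exists, in the direction $[\beta]\in\mathrm{SVect}^*(\Omega)$. -/

import Mathlib

noncomputable section

open Set Filter Topology MeasureTheory TopologicalSpace
open scoped ContDiff

namespace ArnoldBracket

/-! ### Differential calculus in topological vector spaces -/

section Calculus

/-- `L` is the directional derivative `d/dε|_{ε=0} f (x + ε v)`. -/
def HasDirDeriv {X Y : Type*} [AddCommGroup X] [Module ℝ X]
    [AddCommGroup Y] [Module ℝ Y] [TopologicalSpace Y]
    (f : X → Y) (x v : X) (L : Y) : Prop :=
  Tendsto (fun t : ℝ => t⁻¹ • (f (x + t • v) - f x)) (𝓝[≠] 0) (𝓝 L)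

/-- `f` is of class `C^k` in the sense of the differential calculus in Fréchet spaces
(Michal, Bastiani, Hamilton): `f` is continuous and, if `k = j + 1`, all directional derivatives
`df (x, v)` exist and define a map `df : X × X → Y` of class `C^j`. -/
def IsCk {Y : Type*} [AddCommGroup Y] [Module ℝ Y] [TopologicalSpace Y] :
    ℕ → ∀ (X : Type*) [AddCommGroup X] [Module ℝ X] [TopologicalSpace X], (X → Y) → Prop
  | 0, _, _, _, _, f => Continuous f
  | k + 1, X, _, _, _, f => Continuous f ∧
      ∃ df : X × X → Y, (∀ x v, HasDirDeriv f x v (df (x, v))) ∧ IsCk k (X × X) df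

/-- Smooth maps between topological vector spaces. -/
def IsSmooth {X Y : Type*} [AddCommGroup X] [Module ℝ X] [TopologicalSpace X]
    [AddCommGroup Y] [Module ℝ Y] [TopologicalSpace Y] (f : X → Y) : Prop :=
  ∀ k : ℕ, IsCk k X f

end Calculus

/-! ### Smooth functions, fields and forms on the closure of an open set -/

/-- The Euclidean space `ℝⁿ`. -/
abbrev Space (n : ℕ) : Type := EuclideanSpace ℝ (Fin n)

section SmoothFunctions

variable {n : ℕ} (Ω : Opens (Space n)) (V : Type) [NormedAddCommGroup V] [NormedSpace ℝ V]

/-- The functions on the closure of `Ω` that are smooth up to the boundary, i.e. restrictions of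
smooth functions on `ℝⁿ`. -/
def smoothSubmodule : Submodule ℝ (closure (Ω : Set (Space n)) → V) where
  carrier := {f | ∃ g : Space n → V, ContDiff ℝ ∞ g ∧ ∀ x : closure (Ω : Set (Space n)), g x = f x}
  add_mem' := by
    rintro f₁ f₂ ⟨g₁, h₁, e₁⟩ ⟨g₂, h₂, e₂⟩
    exact ⟨g₁ + g₂, h₁.add h₂, fun x => by simp [e₁, e₂]⟩
  zero_mem' := ⟨0, contDiff_const, fun _ => rfl⟩
  smul_mem' := by
    rintro c f ⟨g, h, e⟩
    exact ⟨c • g, h.const_smul c, fun x => by simp [e]⟩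

/-- The space `C^∞(Ω̄, V)`. It is a type of its own because it carries the topology of uniform
convergence of all derivatives, not that of pointwise convergence. -/
def SmoothFn : Type := smoothSubmodule Ω V

namespace SmoothFn

instance : AddCommGroup (SmoothFn Ω V) := inferInstanceAs (AddCommGroup (smoothSubmodule Ω V))

instance : Module ℝ (SmoothFn Ω V) := inferInstanceAs (Module ℝ (smoothSubmodule Ω V))

instance : CoeFun (SmoothFn Ω V) (fun _ => closure (Ω : Set (Space n)) → V) where
  coe f := f.1

variable {Ω V}

/-- A smooth extension of `f` to `ℝⁿ`; its values and its derivatives at the points of the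
closure of `Ω` do not depend on the choice. -/
def ext (f : SmoothFn Ω V) : Space n → V := f.2.choose

theorem contDiff_ext (f : SmoothFn Ω V) : ContDiff ℝ ∞ f.ext := f.2.choose_spec.1

theorem ext_apply (f : SmoothFn Ω V) (x : closure (Ω : Set (Space n))) : f.ext x = f x :=
  f.2.choose_spec.2 x

variable (Ω) in
/-- The restriction to the closure of `Ω` of a smooth function on `ℝⁿ`. -/
def restrict (g : Space n → V) (hg : ContDiff ℝ ∞ g) : SmoothFn Ω V :=
  ⟨fun x => g x, g, hg, fun _ => rfl⟩

@[simp] theorem restrict_apply (g : Space n → V) (hg : ContDiff ℝ ∞ g)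
    (x : closure (Ω : Set (Space n))) : restrict Ω g hg x = g x := rfl

@[simp] theorem add_apply (f g : SmoothFn Ω V) (x : closure (Ω : Set (Space n))) :
    (f + g) x = f x + g x := rfl

@[simp] theorem smul_apply (c : ℝ) (f : SmoothFn Ω V) (x : closure (Ω : Set (Space n))) :
    (c • f) x = c • f x := rfl

theorem eq_of_apply {f g : SmoothFn Ω V} (h : ∀ x, f x = g x) : f = g :=
  Subtype.ext (funext h)

/-- Two smooth functions that agree on the closure of `Ω` have there the same derivatives. -/
theorem iteratedFDeriv_eq {g h : Space n → V} (hg : ContDiff ℝ ∞ g) (hh : ContDiff ℝ ∞ h)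
    (e : EqOn g h (closure (Ω : Set (Space n)))) (k : ℕ) :
    EqOn (iteratedFDeriv ℝ k g) (iteratedFDeriv ℝ k h) (closure (Ω : Set (Space n))) := by
  have hk : (k : ℕ∞ω) ≤ ∞ := by exact_mod_cast le_top
  refine EqOn.closure (s := (Ω : Set (Space n))) (fun x hx => ?_)
    (hg.continuous_iteratedFDeriv hk) (hh.continuous_iteratedFDeriv hk)
  have : g =ᶠ[𝓝 x] h :=
    Filter.eventuallyEq_of_mem (Ω.isOpen.mem_nhds hx) fun y hy => e (subset_closure hy)
  exact (this.iteratedFDeriv ℝ k).eq_of_nhds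

theorem fderiv_eq {g h : Space n → V} (hg : ContDiff ℝ ∞ g) (hh : ContDiff ℝ ∞ h)
    (e : EqOn g h (closure (Ω : Set (Space n)))) :
    EqOn (fderiv ℝ g) (fderiv ℝ h) (closure (Ω : Set (Space n))) := by
  refine EqOn.closure (s := (Ω : Set (Space n))) (fun x hx => ?_)
    (hg.continuous_fderiv (by simp)) (hh.continuous_fderiv (by simp))
  have : g =ᶠ[𝓝 x] h :=
    Filter.eventuallyEq_of_mem (Ω.isOpen.mem_nhds hx) fun y hy => e (subset_closure hy)
  exact this.fderiv_eq

theorem ext_add_eqOn (f g : SmoothFn Ω V) :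
    EqOn (f + g).ext (f.ext + g.ext) (closure (Ω : Set (Space n))) := by
  intro x hx
  have h1 := ext_apply (f + g) ⟨x, hx⟩
  have h2 := ext_apply f ⟨x, hx⟩
  have h3 := ext_apply g ⟨x, hx⟩
  simp_all

theorem ext_smul_eqOn (c : ℝ) (f : SmoothFn Ω V) :
    EqOn (c • f).ext (c • f.ext) (closure (Ω : Set (Space n))) := by
  intro x hx
  have h1 := ext_apply (c • f) ⟨x, hx⟩
  have h2 := ext_apply f ⟨x, hx⟩
  simp_all

theorem contDiff_fderiv {g : Space n → V} (hg : ContDiff ℝ ∞ g) : ContDiff ℝ ∞ (fderiv ℝ g) :=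
  hg.fderiv_right (m := ∞) (by simp)

variable (Ω V) in
/-- The derivative `f ↦ Df`, as a linear map `C^∞(Ω̄, V) → C^∞(Ω̄, L(ℝⁿ, V))`. -/
def D : SmoothFn Ω V →ₗ[ℝ] SmoothFn Ω (Space n →L[ℝ] V) where
  toFun f := restrict Ω (fderiv ℝ f.ext) (contDiff_fderiv f.contDiff_ext)
  map_add' f g := by
    refine eq_of_apply fun x => ?_
    have h := fderiv_eq (f + g).contDiff_ext (f.contDiff_ext.add g.contDiff_ext)
      (ext_add_eqOn f g) x.2
    exact h.trans (fderiv_add (f.contDiff_ext.differentiable (by simp) x)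
      (g.contDiff_ext.differentiable (by simp) x))
  map_smul' c f := by
    refine eq_of_apply fun x => ?_
    have h := fderiv_eq (c • f).contDiff_ext (f.contDiff_ext.const_smul c)
      (ext_smul_eqOn c f) x.2
    exact h.trans (fderiv_const_smul (f.contDiff_ext.differentiable (by simp) x) c)

theorem D_apply (f : SmoothFn Ω V) (x : closure (Ω : Set (Space n))) :
    D Ω V f x = fderiv ℝ f.ext x := rfl

variable (Ω) in
/-- Composition with a linear map `L` between the spaces of values. -/
def comp {W : Type} [NormedAddCommGroup W] [NormedSpace ℝ W] (L : V →L[ℝ] W) :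
    SmoothFn Ω V →ₗ[ℝ] SmoothFn Ω W where
  toFun f := restrict Ω (fun x => L (f.ext x)) (L.contDiff.comp f.contDiff_ext)
  map_add' f g := by
    refine eq_of_apply fun x => ?_
    simp only [restrict_apply, add_apply, ext_apply, map_add]
  map_smul' c f := by
    refine eq_of_apply fun x => ?_
    simp only [restrict_apply, smul_apply, ext_apply, map_smul, RingHom.id_apply]

theorem comp_apply {W : Type} [NormedAddCommGroup W] [NormedSpace ℝ W] (L : V →L[ℝ] W)
    (f : SmoothFn Ω V) (x : closure (Ω : Set (Space n))) : comp Ω L f x = L (f x) :=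
  congrArg L (ext_apply f x)

/-- The `k`-th derivative of `f`, as a continuous function on the closure of `Ω`. -/
def jet (k : ℕ) (f : SmoothFn Ω V) :
    C(closure (Ω : Set (Space n)), ContinuousMultilinearMap ℝ (fun _ : Fin k => Space n) V) :=
  ⟨fun x => iteratedFDeriv ℝ k f.ext x,
    (f.contDiff_ext.continuous_iteratedFDeriv (by exact_mod_cast le_top)).comp
      continuous_subtype_val⟩

/-- The `C^∞` topology: uniform convergence of each derivative on the compact subsets of the
closure of `Ω` (hence on the closure of `Ω` itself if `Ω` is bounded). -/
instance : TopologicalSpace (SmoothFn Ω V) :=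
  ⨅ k : ℕ, TopologicalSpace.induced (jet k) inferInstance

end SmoothFn

end SmoothFunctions

section Geometry

variable {n : ℕ}

/-- `ρ` is a smooth defining function of `Ω` in the open set `U`. -/
def IsDefiningFunction (Ω : Opens (Space n)) (U : Set (Space n)) (ρ : Space n → ℝ) : Prop :=
  IsOpen U ∧ ContDiffOn ℝ ∞ ρ U ∧ (∀ y ∈ U, fderiv ℝ ρ y ≠ 0) ∧
    ∀ y ∈ U, y ∈ Ω ↔ ρ y < 0

/-- `Ω` has a smooth boundary. -/
def HasSmoothBoundary (Ω : Opens (Space n)) : Prop :=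
  ∀ x ∈ frontier (Ω : Set (Space n)), ∃ U ρ, x ∈ U ∧ IsDefiningFunction Ω U ρ

/-- Smooth functions on the closure of `Ω`. -/
abbrev ZeroForm (Ω : Opens (Space n)) : Type := SmoothFn Ω ℝ

/-- Smooth one-forms on the closure of `Ω`. -/
abbrev OneForm (Ω : Opens (Space n)) : Type := SmoothFn Ω (Space n →L[ℝ] ℝ)

/-- Smooth covariant two-tensors on the closure of `Ω`; the two-forms are the alternating ones. -/
abbrev TwoTensor (Ω : Opens (Space n)) : Type := SmoothFn Ω (Space n →L[ℝ] Space n →L[ℝ] ℝ)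

/-- Smooth vector fields on the closure of `Ω`. -/
abbrev VectField (Ω : Opens (Space n)) : Type := SmoothFn Ω (Space n)

variable (Ω : Opens (Space n))

/-- The exterior derivative of functions. -/
def d₀ : ZeroForm Ω →ₗ[ℝ] OneForm Ω := SmoothFn.D Ω ℝ

/-- The antisymmetrization `b(v, w) - b(w, v)` of a bilinear form `b`. -/
def antisymm (n : ℕ) :
    (Space n →L[ℝ] Space n →L[ℝ] ℝ) →L[ℝ] (Space n →L[ℝ] Space n →L[ℝ] ℝ) where
  toFun b := b - b.flip
  map_add' b c := by
    ext v w
    simp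
    ring
  map_smul' r b := by
    ext v w
    simp
    ring
  cont := continuous_id.sub (ContinuousLinearMap.flipₗᵢ ℝ (Space n) (Space n) ℝ).continuous

/-- The exterior derivative of one-forms, `dα (v, w) = (D_v α)(w) - (D_w α)(v)`. -/
def d₁ : OneForm Ω →ₗ[ℝ] TwoTensor Ω :=
  SmoothFn.comp Ω (antisymm n) ∘ₗ SmoothFn.D Ω (Space n →L[ℝ] ℝ)

theorem d₁_apply (α : OneForm Ω) (x : closure (Ω : Set (Space n))) (v w : Space n) :
    d₁ Ω α x v w = fderiv ℝ α.ext x v w - fderiv ℝ α.ext x w v := by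
  rw [d₁, LinearMap.comp_apply, SmoothFn.comp_apply, SmoothFn.D_apply]
  rfl

theorem d₁_d₀ (f : ZeroForm Ω) : d₁ Ω (d₀ Ω f) = 0 := by
  refine SmoothFn.eq_of_apply fun x => ?_
  ext v w
  rw [d₁_apply]
  have h : EqOn (fderiv ℝ (d₀ Ω f).ext) (fderiv ℝ (fderiv ℝ f.ext))
      (closure (Ω : Set (Space n))) :=
    SmoothFn.fderiv_eq (d₀ Ω f).contDiff_ext (SmoothFn.contDiff_fderiv f.contDiff_ext)
      fun y hy => SmoothFn.ext_apply (d₀ Ω f) ⟨y, hy⟩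
  rw [h x.2]
  have hs : IsSymmSndFDerivAt ℝ f.ext (x : Space n) :=
    f.contDiff_ext.contDiffAt.isSymmSndFDerivAt (by
      rw [minSmoothness_of_isRCLikeNormedField]
      exact WithTop.coe_le_coe.2 le_top)
  rw [hs.eq v w, sub_self]
  rfl

/-- The contraction `i_u w = w(u, ·)`. -/
def contract (u : VectField Ω) (w : TwoTensor Ω) : OneForm Ω :=
  SmoothFn.restrict Ω (fun x => w.ext x (u.ext x)) (w.contDiff_ext.clm_apply u.contDiff_ext)

/-- The Lie bracket `[u, v] = D_u v - D_v u` of vector fields. -/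
def bracket (u v : VectField Ω) : VectField Ω :=
  SmoothFn.restrict Ω (VectorField.lieBracket ℝ u.ext v.ext)
    (((SmoothFn.contDiff_fderiv v.contDiff_ext).clm_apply u.contDiff_ext).sub
      ((SmoothFn.contDiff_fderiv u.contDiff_ext).clm_apply v.contDiff_ext))

/-- The divergence `∑ ∂ᵢ uᵢ` of a vector field. -/
def divergence (u : VectField Ω) (x : closure (Ω : Set (Space n))) : ℝ :=
  ∑ i : Fin n, (SmoothFn.D Ω _ u x (EuclideanSpace.single i 1)) i

/-- `u` is tangent to the boundary, i.e. `dρ(u) = 0` at the boundary points for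
the defining functions `ρ` (whose gradients are normal to the boundary). -/
def IsTangentToBoundary (u : VectField Ω) : Prop :=
  ∀ U ρ, IsDefiningFunction Ω U ρ →
    ∀ x : closure (Ω : Set (Space n)), (x : Space n) ∈ frontier (Ω : Set (Space n)) →
      (x : Space n) ∈ U → fderiv ℝ ρ x (u x) = 0

/-- `SVect(Ω)`: the divergence-free vector fields tangent to the boundary, with the topology
induced by the `C^∞` topology. -/
def SVect : Submodule ℝ (VectField Ω) where
  carrier := {u | (∀ x, divergence Ω u x = 0) ∧ IsTangentToBoundary Ω u}
  add_mem' := by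
    rintro u v ⟨hu, hu'⟩ ⟨hv, hv'⟩
    refine ⟨fun x => ?_, fun U ρ h x hx hxU => ?_⟩
    · have h1 := hu x
      have h2 := hv x
      simp only [divergence] at h1 h2 ⊢
      simp [map_add, Finset.sum_add_distrib, h1, h2]
    · simp [hu' U ρ h x hx hxU, hv' U ρ h x hx hxU]
  zero_mem' := by
    refine ⟨fun x => ?_, fun U ρ h x hx hxU => ?_⟩
    · simp only [divergence, map_zero]
      exact Finset.sum_eq_zero fun i _ => rfl
    · exact map_zero _
  smul_mem' := by
    rintro c u ⟨hu, hu'⟩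
    refine ⟨fun x => ?_, fun U ρ h x hx hxU => ?_⟩
    · have h1 := hu x
      simp only [divergence] at h1 ⊢
      simp [map_smul, ← Finset.mul_sum, h1]
    · simp [hu' U ρ h x hx hxU]

/-- `∫_Ω α(u) dV`. -/
def pairing (α : OneForm Ω) (u : VectField Ω) : ℝ :=
  ∫ x in (Ω : Set (Space n)), α.ext x (u.ext x)

/-- The regular dual `SVect*(Ω) = Ω¹(Ω) / dΩ⁰(Ω)` with the quotient topology; the class `[α]`
stands for the linear functional `u ↦ ∫_Ω α(u) dV` on `SVect(Ω)`. -/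
abbrev SVectDual : Type := OneForm Ω ⧸ LinearMap.range (d₀ Ω)

/-- The class `[α]` of a one-form. -/
def cls (α : OneForm Ω) : SVectDual Ω := Submodule.Quotient.mk α

/-- The vorticity `ω = dα` of a class `[α]`. -/
def vorticity : SVectDual Ω →ₗ[ℝ] TwoTensor Ω :=
  (LinearMap.range (d₀ Ω)).liftQ (d₁ Ω) (by
    rintro _ ⟨f, rfl⟩
    exact d₁_d₀ Ω f)

/-! ### Admissible functionals and the bracket -/

/-- `u` is a smooth `L²` gradient of the functional `F` in `SVect(Ω)`. -/
def IsL2Gradient (F : SVectDual Ω → ℝ) (u : SVectDual Ω → SVect Ω) : Prop :=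
  IsSmooth u ∧ ∀ (m : SVectDual Ω) (δα : OneForm Ω),
    HasDirDeriv F m (cls Ω δα) (pairing Ω δα (u m))

open Classical in
/-- The `L²` gradient `δF` of a functional that has one (and `0` otherwise). -/
def grad (F : SVectDual Ω → ℝ) : SVectDual Ω → SVect Ω :=
  if h : ∃ u, IsL2Gradient Ω F u then h.choose else 0

/-- Arnold's bracket `{F, G}(ω) = ∫_Ω ω(δF, δG) dV`. -/
def arnoldBracket (F G : SVectDual Ω → ℝ) (m : SVectDual Ω) : ℝ :=
  ∫ x in (Ω : Set (Space n)), (vorticity Ω m).ext x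
    ((grad Ω F m : VectField Ω).ext x) ((grad Ω G m : VectField Ω).ext x)

/-- The admissible functionals on `SVect*(Ω)`: the smooth functionals that have a smooth
`L²` gradient in `SVect(Ω)`. -/
def admissible : Set (SVectDual Ω → ℝ) :=
  {F | IsSmooth F ∧ ∃ u, IsL2Gradient Ω F u}

end Geometry

/-- `A` is a linear space of functionals on `X`, and `br` is a Hamiltonian structure on `A`. -/
structure IsHamiltonianStructure {X : Type*} (A : Set (X → ℝ))
    (br : (X → ℝ) → (X → ℝ) → (X → ℝ)) : Prop where
  zero_mem : (0 : X → ℝ) ∈ A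
  add_mem : ∀ F ∈ A, ∀ G ∈ A, F + G ∈ A
  smul_mem : ∀ (c : ℝ), ∀ F ∈ A, c • F ∈ A
  add_left : ∀ F ∈ A, ∀ G ∈ A, ∀ H ∈ A, br (F + G) H = br F H + br G H
  smul_left : ∀ (c : ℝ), ∀ F ∈ A, ∀ G ∈ A, br (c • F) G = c • br F G
  add_right : ∀ F ∈ A, ∀ G ∈ A, ∀ H ∈ A, br F (G + H) = br F G + br F H
  smul_right : ∀ (c : ℝ), ∀ F ∈ A, ∀ G ∈ A, br F (c • G) = c • br F G
  closed : ∀ F ∈ A, ∀ G ∈ A, br F G ∈ A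
  skew : ∀ F ∈ A, ∀ G ∈ A, br G F = - br F G
  jacobi : ∀ F ∈ A, ∀ G ∈ A, ∀ H ∈ A,
    br (br F G) H + br (br G H) F + br (br H F) G = 0

end ArnoldBracket

end

open ArnoldBracket

noncomputable section

open Set Filter Topology MeasureTheory TopologicalSpace
open scoped ContDiff

namespace ArnoldBracket

/-! ### Chain rule and product rule for directional derivatives -/

section DirectionalDerivatives

universe u v w

variable {X : Type u} [AddCommGroup X] [Module ℝ X]
  {Y : Type v} [AddCommGroup Y] [Module ℝ Y] [TopologicalSpace Y]
  {Z : Type w} [AddCommGroup Z] [Module ℝ Z] [TopologicalSpace Z]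

/-! `SVect Ω` is a Lie algebra and the bracket is, up to sign, the Lie–Poisson bracket on its
regular dual. Cartan's formula reads $d\alpha(u,v)=u(\alpha(v))-v(\alpha(u))-\alpha([u,v])$. A
divergence-free field tangent to the boundary is $L^2$-orthogonal to gradients
(`setIntegral_fderiv_apply_eq_zero`), so the first two terms integrate to zero and
$\int\omega(u,v)=-\int\alpha([u,v])$ (`pairing_contract_d₁`).

For the gradient, $\int\omega(\delta F,\delta G)$ is differentiated in a direction $[\beta]$ by the
product rule. The variation of $\omega$ is $d\beta$ and contributes $-\int\beta([\delta F,\delta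
G])$ by the same formula. The other two terms contain $D_{[\beta]}\delta F$ and $D_{[\beta]}\delta
G$; symmetry of second derivatives (`IsL2Gradient.hessian_symm`) moves $\beta$ out of the direction
and into the pairing. The resulting vector lies in `SVect Ω` because gradients take values there and
the Lie bracket preserves it (`bracket_mem_SVect`).

In the Jacobi sum each of $F,G,H$ contributes two Hessian terms, which cancel by the same symmetry;
what remains is $\alpha$ paired with the cyclic sum of double Lie brackets, which is zero.

The analysis behind this: in Bastiani calculus, products need a jointly continuous bilinear map
(`IsCk.bilin`) and compositions a locally convex target (`IsCk.comp`); pointwise products are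
jointly continuous on $C^\infty(\bar\Omega)$ (`SmoothFn.continuous_bil`). Orthogonality to gradients
is proved with cutoffs near the boundary, without surface integrals. -/

theorem HasDirDeriv.unique [T2Space Y] {f : X → Y} {x v : X} {L L' : Y}
    (h : HasDirDeriv f x v L) (h' : HasDirDeriv f x v L') : L = L' :=
  tendsto_nhds_unique h h'

theorem HasDirDeriv.congr_deriv {f : X → Y} {x v : X} {L L' : Y}
    (h : HasDirDeriv f x v L) (e : L = L') : HasDirDeriv f x v L' := e ▸ h

theorem HasDirDeriv.clm_comp {f : X → Y} {x v : X} {l : Y} (h : HasDirDeriv f x v l)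
    (L : Y →L[ℝ] Z) : HasDirDeriv (fun x => L (f x)) x v (L l) := by
  have := (L.continuous.tendsto l).comp h
  refine this.congr fun t => ?_
  simp [map_sub]

theorem HasDirDeriv.prodMk {f : X → Y} {g : X → Z} {x v : X} {l : Y} {m : Z}
    (hf : HasDirDeriv f x v l) (hg : HasDirDeriv g x v m) :
    HasDirDeriv (fun x => (f x, g x)) x v (l, m) := by
  refine (hf.prodMk_nhds hg).congr fun t => ?_
  simp

/-- Mean value theorem: the difference quotient lies in any open convex set containing the
directional derivatives along the segment. -/
theorem slope_mem_of_hasDirDeriv [IsTopologicalAddGroup Y] [ContinuousSMul ℝ Y]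
    {g : X → Y} {g' : X → Y} {x v : X} (hg : ∀ x, HasDirDeriv g x v (g' x))
    {C : Set Y} (hC : Convex ℝ C) (hCo : IsOpen C) {t : ℝ} (ht : t ≠ 0)
    (hmem : ∀ r : ℝ, |r| ≤ |t| → g' (x + r • v) ∈ C) :
    t⁻¹ • (g (x + t • v) - g x) ∈ C := by
  by_contra hn
  -- A functional separating the quotient from `C` reduces to the scalar mean value theorem: `L` of
  -- the quotient equals `L` of some derivative in `C`, hence is smaller than itself.
  obtain ⟨L, hL⟩ := geometric_hahn_banach_open_point hC hCo hn
  have hd : ∀ s : ℝ, HasDerivAt (fun s : ℝ => L (g (x + (s * t) • v)))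
      (t * L (g' (x + (s * t) • v))) s := by
    intro s
    have h1 : HasDerivAt (fun r : ℝ => L (g (x + r • v))) (L (g' (x + (s * t) • v))) (s * t) := by
      rw [hasDerivAt_iff_tendsto_slope_zero]
      refine Tendsto.congr (fun r => ?_) ((hg (x + (s * t) • v)).clm_comp L)
      rw [add_assoc, ← add_smul]
    have h2 := h1.scomp s ((hasDerivAt_id s).mul_const t)
    simpa [Function.comp_def] using h2
  obtain ⟨c, hc, hc'⟩ := exists_hasDerivAt_eq_slope _ _ (zero_lt_one' ℝ)
    (fun s _ => (hd s).continuousAt.continuousWithinAt) (fun s _ => hd s)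
  have h3 := hL _ (hmem (c * t) (by
    rw [abs_mul, abs_of_pos hc.1]
    exact mul_le_of_le_one_left (abs_nonneg t) hc.2.le))
  simp only [one_mul, zero_mul, zero_smul, add_zero, sub_zero, div_one] at hc'
  rw [map_smul, map_sub, ← hc', smul_eq_mul, inv_mul_cancel_left₀ ht] at h3
  exact lt_irrefl _ h3

/-- With $q_t\to l$ the difference quotient of $f$, one has $f(x+tv)=f(x)+tq_t$, so the mean value
theorem in direction $q_t$ puts the quotient of $g\circ f$ into any convex neighbourhood of
$dg(f(x),l)$ for small $t$. The direction varies with $t$, hence the need for joint continuity of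
`dg`; local convexity supplies the neighbourhoods. -/
theorem HasDirDeriv.comp [ContinuousAdd Z] [ContinuousSMul ℝ Z]
    [IsTopologicalAddGroup Y] [ContinuousSMul ℝ Y] [LocallyConvexSpace ℝ Y]
    {f : X → Z} {g : Z → Y} {dg : Z × Z → Y} {x v : X} {l : Z}
    (hg : ∀ z w, HasDirDeriv g z w (dg (z, w))) (hdg : Continuous dg)
    (hf : HasDirDeriv f x v l) : HasDirDeriv (fun x => g (f x)) x v (dg (f x, l)) := by
  intro S hS
  obtain ⟨C, ⟨hC0, hCo, hC⟩, hCS⟩ := (LocallyConvexSpace.convex_open_basis_zero ℝ Y).mem_iff.1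
    (show (fun y => dg (f x, l) + y) ⁻¹' S ∈ 𝓝 (0 : Y) from
      ((continuous_const.add continuous_id).tendsto' 0 _ (by simp)) hS)
  set C' : Set Y := (fun y => y - dg (f x, l)) ⁻¹' C with hC'
  have hC'o : IsOpen C' := hCo.preimage (continuous_id.sub continuous_const)
  have hC'c : Convex ℝ C' := by
    have := hC.translate_preimage_left (-dg (f x, l))
    simpa [hC', sub_eq_add_neg] using this
  have hC'S : C' ⊆ S := fun y hy => by simpa using hCS hy
  have hcont : Continuous fun p : ℝ × Z => dg (f x + p.1 • p.2, p.2) := by fun_prop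
  have hW : ∀ᶠ p : ℝ × Z in 𝓝 (0 : ℝ) ×ˢ 𝓝 l, dg (f x + p.1 • p.2, p.2) ∈ C' := by
    rw [← nhds_prod_eq]
    refine hcont.continuousAt.eventually (hC'o.mem_nhds ?_)
    simpa [hC'] using hC0
  obtain ⟨p, hp, q, hq, hpq⟩ := eventually_prod_iff.1 hW
  obtain ⟨δ, hδ, hball⟩ := Metric.eventually_nhds_iff.1 hp
  have hsmall : ∀ᶠ t : ℝ in 𝓝[≠] 0, |t| < δ := by
    refine nhdsWithin_le_nhds ?_
    filter_upwards [Metric.ball_mem_nhds (0 : ℝ) hδ] with t ht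
    simpa using ht
  change ∀ᶠ t : ℝ in 𝓝[≠] 0, t⁻¹ • (g (f (x + t • v)) - g (f x)) ∈ S
  filter_upwards [hsmall, hf.eventually hq, self_mem_nhdsWithin] with t ht hqt ht0
  have ht0 : t ≠ 0 := ht0
  refine hC'S ?_
  have key := slope_mem_of_hasDirDeriv (x := f x) (v := t⁻¹ • (f (x + t • v) - f x))
    (g' := fun z => dg (z, t⁻¹ • (f (x + t • v) - f x))) (fun z => hg z _) hC'c hC'o ht0
    (fun r hr => hpq (hball (by simpa using lt_of_le_of_lt hr ht)) hqt)
  simpa [smul_smul, ht0] using key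

variable [TopologicalSpace X]

theorem HasDirDeriv.comp_clm {f : X → Y} (L : Z →L[ℝ] X) {z v : Z} {l : Y}
    (h : HasDirDeriv f (L z) (L v) l) : HasDirDeriv (fun z => f (L z)) z v l := by
  refine Tendsto.congr (fun t => ?_) h
  simp

theorem hasDirDeriv_clm (L : X →L[ℝ] Y) (x v : X) : HasDirDeriv L x v (L v) := by
  refine tendsto_const_nhds.congr' ?_
  filter_upwards [self_mem_nhdsWithin] with t ht
  have ht : t ≠ 0 := ht
  simp [smul_smul, ht]

theorem tendsto_add_smul [ContinuousAdd X] [ContinuousSMul ℝ X] (x v : X) :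
    Tendsto (fun t : ℝ => x + t • v) (𝓝[≠] 0) (𝓝 x) := by
  have h : Continuous fun t : ℝ => x + t • v := by fun_prop
  simpa using (h.tendsto 0).mono_left nhdsWithin_le_nhds

/-- The increment splits as $B(\Delta f,g(x+tv))+B(f(x),\Delta g)$, so joint continuity of `B`
suffices and no local convexity is needed. -/
theorem HasDirDeriv.bilin [ContinuousAdd X] [ContinuousSMul ℝ X]
    {W : Type*} [AddCommGroup W] [Module ℝ W] [TopologicalSpace W] [ContinuousAdd W]
    (B : Y →ₗ[ℝ] Z →ₗ[ℝ] W) (hB : Continuous fun p : Y × Z => B p.1 p.2)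
    {f : X → Y} {g : X → Z} {x v : X} {l : Y} {m : Z} (hgc : Continuous g)
    (hf : HasDirDeriv f x v l) (hg : HasDirDeriv g x v m) :
    HasDirDeriv (fun x => B (f x) (g x)) x v (B l (g x) + B (f x) m) := by
  have h1 : Tendsto (fun t : ℝ => g (x + t • v)) (𝓝[≠] 0) (𝓝 (g x)) :=
    (hgc.tendsto x).comp (tendsto_add_smul x v)
  have h2 := (hB.tendsto (l, g x)).comp (hf.prodMk_nhds h1)
  have h3 := (hB.tendsto (f x, m)).comp ((tendsto_const_nhds (x := f x)).prodMk_nhds hg)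
  refine (h2.add h3).congr fun t => ?_
  simp only [Function.comp_apply, map_smul, map_sub, LinearMap.smul_apply, LinearMap.sub_apply]
  rw [← smul_add]
  congr 1
  abel

end DirectionalDerivatives

/-! ### Maps of class $C^k$ between topological vector spaces -/

section Smoothness

universe u v w

variable {X : Type u} [AddCommGroup X] [Module ℝ X] [TopologicalSpace X]
  {Y : Type v} [AddCommGroup Y] [Module ℝ Y] [TopologicalSpace Y]
  {Z : Type w} [AddCommGroup Z] [Module ℝ Z] [TopologicalSpace Z]

theorem IsCk.continuous {k : ℕ} {f : X → Y} (h : IsCk k X f) : Continuous f := by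
  cases k with
  | zero => exact h
  | succ k => exact h.1

theorem IsCk.of_succ {k : ℕ} {X : Type u} [AddCommGroup X] [Module ℝ X] [TopologicalSpace X]
    {f : X → Y} (h : IsCk (k + 1) X f) : IsCk k X f := by
  induction k generalizing X with
  | zero => exact h.1
  | succ k ih =>
    obtain ⟨hc, df, hdf, h⟩ := h
    exact ⟨hc, df, hdf, ih h⟩

theorem IsCk.comp_clm {k : ℕ} {X : Type u} [AddCommGroup X] [Module ℝ X] [TopologicalSpace X]
    {Z : Type w} [AddCommGroup Z] [Module ℝ Z] [TopologicalSpace Z]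
    {f : X → Y} (h : IsCk k X f) (L : Z →L[ℝ] X) : IsCk k Z fun z => f (L z) := by
  induction k generalizing X Z with
  | zero => exact Continuous.comp h L.continuous
  | succ k ih =>
    obtain ⟨hc, df, hdf, h⟩ := h
    exact ⟨hc.comp L.continuous, fun p => df (L.prodMap L p),
      fun x v => (hdf (L x) (L v)).comp_clm L, ih h (L.prodMap L)⟩

/-- Treated apart from `IsCk.comp` because no local convexity is asked of the target; this allows
the quotient `SVectDual Ω` as a target. -/
theorem IsCk.clm_comp {k : ℕ} {X : Type u} [AddCommGroup X] [Module ℝ X] [TopologicalSpace X]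
    {f : X → Y} (h : IsCk k X f) (L : Y →L[ℝ] Z) : IsCk k X fun x => L (f x) := by
  induction k generalizing X with
  | zero => exact L.continuous.comp h
  | succ k ih =>
    obtain ⟨hc, df, hdf, h⟩ := h
    exact ⟨L.continuous.comp hc, fun p => L (df p), fun x v => (hdf x v).clm_comp L, ih h⟩

theorem IsCk.prodMk {k : ℕ} {X : Type u} [AddCommGroup X] [Module ℝ X] [TopologicalSpace X]
    {f : X → Y} {g : X → Z} (hf : IsCk k X f) (hg : IsCk k X g) :
    IsCk k X fun x => (f x, g x) := by
  induction k generalizing X with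
  | zero => exact Continuous.prodMk hf hg
  | succ k ih =>
    obtain ⟨hfc, df, hdf, hf⟩ := hf
    obtain ⟨hgc, dg, hdg, hg⟩ := hg
    exact ⟨hfc.prodMk hgc, fun p => (df p, dg p), fun x v => (hdf x v).prodMk (hdg x v), ih hf hg⟩

theorem isCk_clm (k : ℕ) {X : Type u} [AddCommGroup X] [Module ℝ X] [TopologicalSpace X]
    (L : X →L[ℝ] Y) : IsCk k X L := by
  induction k generalizing X with
  | zero => exact L.continuous
  | succ k ih =>
    exact ⟨L.continuous, L.comp (ContinuousLinearMap.snd ℝ X X), fun x v => hasDirDeriv_clm L x v,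
      ih _⟩

theorem IsCk.add [ContinuousAdd Y] {k : ℕ} {f g : X → Y} (hf : IsCk k X f) (hg : IsCk k X g) :
    IsCk k X fun x => f x + g x :=
  (hf.prodMk hg).clm_comp (ContinuousLinearMap.fst ℝ Y Y + ContinuousLinearMap.snd ℝ Y Y)

theorem IsCk.sub [IsTopologicalAddGroup Y] {k : ℕ} {f g : X → Y} (hf : IsCk k X f)
    (hg : IsCk k X g) : IsCk k X fun x => f x - g x :=
  (hf.prodMk hg).clm_comp (ContinuousLinearMap.fst ℝ Y Y - ContinuousLinearMap.snd ℝ Y Y)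

theorem IsCk.bilin {W : Type*} [AddCommGroup W] [Module ℝ W] [TopologicalSpace W]
    [ContinuousAdd W] (B : Y →ₗ[ℝ] Z →ₗ[ℝ] W) (hB : Continuous fun p : Y × Z => B p.1 p.2)
    {k : ℕ} {X : Type u} [AddCommGroup X] [Module ℝ X] [TopologicalSpace X]
    [ContinuousAdd X] [ContinuousSMul ℝ X] {f : X → Y} {g : X → Z}
    (hf : IsCk k X f) (hg : IsCk k X g) : IsCk k X fun x => B (f x) (g x) := by
  induction k generalizing X with
  | zero => exact hB.comp (Continuous.prodMk hf hg)
  | succ k ih =>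
    have hf' := hf.of_succ
    have hg' := hg.of_succ
    obtain ⟨hfc, df, hdf, hf⟩ := hf
    obtain ⟨hgc, dg, hdg, hg⟩ := hg
    exact ⟨hB.comp (hfc.prodMk hgc), fun p => B (df p) (g p.1) + B (f p.1) (dg p),
      fun x v => (hdf x v).bilin B hB hgc (hdg x v),
      (ih hf (hg'.comp_clm (ContinuousLinearMap.fst ℝ X X))).add
        (ih (hf'.comp_clm (ContinuousLinearMap.fst ℝ X X)) hg)⟩

/-- The derivative $(x,v)\mapsto dg(f(x),df(x,v))$ is again a composition, one order lower and on `X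
× X`; the induction therefore has to run over all spaces at once. -/
theorem IsCk.comp [IsTopologicalAddGroup Y] [ContinuousSMul ℝ Y] [LocallyConvexSpace ℝ Y]
    {k : ℕ} {X : Type u} [AddCommGroup X] [Module ℝ X] [TopologicalSpace X]
    {Z : Type w} [AddCommGroup Z] [Module ℝ Z] [TopologicalSpace Z]
    [ContinuousAdd Z] [ContinuousSMul ℝ Z] {f : X → Z} {g : Z → Y}
    (hg : IsCk k Z g) (hf : IsCk k X f) : IsCk k X fun x => g (f x) := by
  induction k generalizing X Z with
  | zero => exact Continuous.comp hg hf
  | succ k ih =>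
    have hf' := hf.of_succ
    obtain ⟨hgc, dg, hdg, hg⟩ := hg
    obtain ⟨hfc, df, hdf, hf⟩ := hf
    exact ⟨hgc.comp hfc, fun p => dg (f p.1, df p),
      fun x v => HasDirDeriv.comp hdg hg.continuous (hdf x v),
      ih hg ((hf'.comp_clm (ContinuousLinearMap.fst ℝ X X)).prodMk hf)⟩

/-- The directional derivative of a smooth map is smooth. -/
theorem IsSmooth.exists_dirDeriv [T2Space Y] {f : X → Y} (h : IsSmooth f) :
    ∃ df : X × X → Y, (∀ x v, HasDirDeriv f x v (df (x, v))) ∧ IsSmooth df := by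
  obtain ⟨_, df, hdf, -⟩ := h 1
  refine ⟨df, hdf, fun k => ?_⟩
  -- Each order `k` comes with its own derivative map; uniqueness of limits identifies them all with
  -- `df`.
  obtain ⟨_, df', hdf', hk⟩ := h (k + 1)
  convert hk
  ext ⟨x, v⟩
  exact (hdf x v).unique (hdf' x v)

end Smoothness

/-! ### Symmetry of second directional derivatives -/

section Hessian

variable {X : Type*} [AddCommGroup X] [Module ℝ X]

theorem hasDerivAt_of_hasDirDeriv {F : X → ℝ} {x v : X} {s L : ℝ}
    (h : HasDirDeriv F (x + s • v) v L) : HasDerivAt (fun r : ℝ => F (x + r • v)) L s := by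
  rw [hasDerivAt_iff_tendsto_slope_zero]
  refine Tendsto.congr (fun r => ?_) h
  rw [add_assoc, ← add_smul]

/-- The mean value theorem is applied twice, first in direction `b` to the increment of `F` along
`c`, then in direction `c`. The second difference is symmetric in `b` and `c`, which is what makes
mixed derivatives agree. -/
theorem exists_second_difference {F P H : X → ℝ} {b c : X}
    (hF : ∀ x, HasDirDeriv F x b (P x)) (hP : ∀ x, HasDirDeriv P x c (H x)) (x : X) {t : ℝ}
    (ht : 0 < t) : ∃ r ∈ Icc 0 t, ∃ s ∈ Icc 0 t, H (x + r • b + s • c) * t ^ 2 =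
      F (x + t • b + t • c) - F (x + t • b) - F (x + t • c) + F x := by
  have h1 : ∀ r : ℝ, HasDerivAt (fun r : ℝ => F (x + t • c + r • b) - F (x + r • b))
      (P (x + t • c + r • b) - P (x + r • b)) r := fun r =>
    (hasDerivAt_of_hasDirDeriv (hF _)).sub (hasDerivAt_of_hasDirDeriv (hF _))
  obtain ⟨r, hr, hr'⟩ := exists_hasDerivAt_eq_slope _ _ ht
    (fun s _ => (h1 s).continuousAt.continuousWithinAt) (fun s _ => h1 s)
  have h2 : ∀ s : ℝ, HasDerivAt (fun s : ℝ => P (x + r • b + s • c)) (H (x + r • b + s • c)) s :=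
    fun s => hasDerivAt_of_hasDirDeriv (hP _)
  obtain ⟨s, hs, hs'⟩ := exists_hasDerivAt_eq_slope _ _ ht
    (fun s _ => (h2 s).continuousAt.continuousWithinAt) (fun s _ => h2 s)
  refine ⟨r, ⟨hr.1.le, hr.2.le⟩, s, ⟨hs.1.le, hs.2.le⟩, ?_⟩
  have e1 : x + t • c + t • b = x + t • b + t • c := by abel
  have e2 : x + t • c + r • b = x + r • b + t • c := by abel
  rw [eq_div_iff (by linarith)] at hr' hs'
  simp only [zero_smul, add_zero, sub_zero, e1, e2] at hr' hs'
  rw [pow_two, ← mul_assoc, hs', hr']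
  ring

variable [TopologicalSpace X]

/-- Symmetry of second directional derivatives. -/
theorem second_dirDeriv_symm [ContinuousAdd X] [ContinuousSMul ℝ X]
    {F P Q H K : X → ℝ} {b c : X}
    (hFb : ∀ x, HasDirDeriv F x b (P x)) (hPc : ∀ x, HasDirDeriv P x c (H x))
    (hFc : ∀ x, HasDirDeriv F x c (Q x)) (hQb : ∀ x, HasDirDeriv Q x b (K x))
    (hH : Continuous H) (hK : Continuous K) (x : X) : H x = K x := by
  have hcH : Continuous fun p : ℝ × ℝ => H (x + p.1 • b + p.2 • c) := by fun_prop
  have hcK : Continuous fun p : ℝ × ℝ => K (x + p.2 • b + p.1 • c) := by fun_prop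
  refine eq_of_forall_dist_le fun ε hε => ?_
  have e1 : ∀ᶠ p in 𝓝 (0 : ℝ × ℝ), dist (H (x + p.1 • b + p.2 • c)) (H x) < ε / 2 :=
    (hcH.tendsto' 0 (H x) (by simp)).eventually (Metric.ball_mem_nhds _ (half_pos hε))
  have e2 : ∀ᶠ p in 𝓝 (0 : ℝ × ℝ), dist (K (x + p.2 • b + p.1 • c)) (K x) < ε / 2 :=
    (hcK.tendsto' 0 (K x) (by simp)).eventually (Metric.ball_mem_nhds _ (half_pos hε))
  obtain ⟨δ, hδ, hball⟩ := Metric.eventually_nhds_iff.1 (e1.and e2)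
  have hpos : (0 : ℝ) < δ / 2 := half_pos hδ
  obtain ⟨r, hr, s, hs, h1⟩ := exists_second_difference hFb hPc x hpos
  obtain ⟨r', hr', s', hs', h2⟩ := exists_second_difference hFc hQb x hpos
  have hd : ∀ r ∈ Icc 0 (δ / 2), ∀ s ∈ Icc 0 (δ / 2), dist ((r, s) : ℝ × ℝ) 0 < δ := by
    rintro r ⟨hr0, hr1⟩ s ⟨hs0, hs1⟩
    rw [Prod.dist_eq, max_lt_iff]
    simp only [Prod.fst_zero, Prod.snd_zero, dist_zero_right, Real.norm_eq_abs, abs_of_nonneg hr0,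
      abs_of_nonneg hs0]
    constructor <;> linarith
  have d1 := (hball (hd r hr s hs)).1
  have d2 := (hball (hd r' hr' s' hs')).2
  have e : H (x + r • b + s • c) = K (x + s' • b + r' • c) := by
    have a1 : x + (δ / 2) • c + (δ / 2) • b = x + (δ / 2) • b + (δ / 2) • c := by abel
    have a2 : x + r' • c + s' • b = x + s' • b + r' • c := by abel
    rw [a1, a2] at h2
    refine mul_right_cancel₀ (b := (δ / 2) ^ 2) (by positivity) ?_
    rw [h1, h2]
    ring
  simp only at d1 d2
  rw [e, dist_comm] at d1
  have := dist_triangle (H x) (K (x + s' • b + r' • c)) (K x)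
  linarith

end Hessian

/-! ### The space $C^\infty(\bar\Omega,V)$ and its continuous operations -/

namespace SmoothFn

variable {n : ℕ} {Ω : Opens (Space n)} {V : Type} [NormedAddCommGroup V] [NormedSpace ℝ V]
  {W : Type} [NormedAddCommGroup W] [NormedSpace ℝ W]
  {U : Type} [NormedAddCommGroup U] [NormedSpace ℝ U]

theorem jet_apply (k : ℕ) (f : SmoothFn Ω V) (x : closure (Ω : Set (Space n))) :
    jet k f x = iteratedFDeriv ℝ k f.ext x := rfl

theorem natCast_le_infty (k : ℕ) : (k : ℕ∞ω) ≤ ∞ := by exact_mod_cast le_top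

/-- Jets on the closure may be computed from any smooth extension, not only the chosen one. -/
theorem jet_eq {g : Space n → V} (hg : ContDiff ℝ ∞ g) {f : SmoothFn Ω V}
    (e : ∀ x : closure (Ω : Set (Space n)), f x = g x) (k : ℕ)
    (x : closure (Ω : Set (Space n))) : jet k f x = iteratedFDeriv ℝ k g x :=
  iteratedFDeriv_eq f.contDiff_ext hg
    (fun y hy => (ext_apply f ⟨y, hy⟩).trans (e ⟨y, hy⟩)) k x.2

theorem fderiv_ext_eq {g : Space n → V} (hg : ContDiff ℝ ∞ g) {f : SmoothFn Ω V}
    (e : ∀ x : closure (Ω : Set (Space n)), f x = g x)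
    (x : closure (Ω : Set (Space n))) : fderiv ℝ f.ext x = fderiv ℝ g x :=
  fderiv_eq f.contDiff_ext hg
    (fun y hy => (ext_apply f ⟨y, hy⟩).trans (e ⟨y, hy⟩)) x.2

theorem ext_restrict {g : Space n → V} (hg : ContDiff ℝ ∞ g) {x : Space n}
    (hx : x ∈ closure (Ω : Set (Space n))) : (restrict Ω g hg).ext x = g x :=
  ext_apply (restrict Ω g hg) ⟨x, hx⟩

theorem ext_add (f g : SmoothFn Ω V) {x : Space n} (hx : x ∈ closure (Ω : Set (Space n))) :
    (f + g).ext x = f.ext x + g.ext x := ext_add_eqOn f g hx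

theorem ext_smul (c : ℝ) (f : SmoothFn Ω V) {x : Space n}
    (hx : x ∈ closure (Ω : Set (Space n))) : (c • f).ext x = c • f.ext x :=
  ext_smul_eqOn c f hx

variable (Ω V) in
/-- The `k`-th derivative as a linear map. -/
def jetₗ (k : ℕ) : SmoothFn Ω V →ₗ[ℝ] C(closure (Ω : Set (Space n)),
    ContinuousMultilinearMap ℝ (fun _ : Fin k => Space n) V) where
  toFun := jet k
  map_add' f g := by
    ext1 x
    rw [jet_eq (f.contDiff_ext.add g.contDiff_ext)
      (fun x => by rw [add_apply, ← ext_apply f, ← ext_apply g]) k x]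
    exact iteratedFDeriv_add_apply (f.contDiff_ext.of_le (natCast_le_infty k)).contDiffAt
      (g.contDiff_ext.of_le (natCast_le_infty k)).contDiffAt
  map_smul' c f := by
    ext1 x
    rw [jet_eq (f.contDiff_ext.const_smul c)
      (fun x => by rw [smul_apply, ← ext_apply f]) k x]
    exact iteratedFDeriv_const_smul_apply (f.contDiff_ext.of_le (natCast_le_infty k)).contDiffAt

/-- The topology is an infimum of topologies induced by linear maps into normed or compact-open
spaces; this property and the next two pass to such infima. -/
instance : IsTopologicalAddGroup (SmoothFn Ω V) :=
  topologicalAddGroup_iInf fun k => topologicalAddGroup_induced (jetₗ Ω V k)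

instance : ContinuousSMul ℝ (SmoothFn Ω V) :=
  continuousSMul_iInf fun k => continuousSMul_induced (jetₗ Ω V k)

instance : LocallyConvexSpace ℝ (SmoothFn Ω V) :=
  LocallyConvexSpace.iInf fun k => LocallyConvexSpace.induced (jetₗ Ω V k)

theorem continuous_jet (k : ℕ) : Continuous (jet k : SmoothFn Ω V → _) :=
  continuous_iInf_dom (i := k) continuous_induced_dom

theorem continuous_iff {X : Type*} [TopologicalSpace X] {f : X → SmoothFn Ω V} :
    Continuous f ↔ ∀ k, Continuous fun x => jet k (f x) := by
  rw [continuous_iInf_rng]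
  exact forall_congr' fun k => continuous_induced_rng

/-- The underlying continuous function. -/
def toContinuousMap : SmoothFn Ω V →L[ℝ] C(closure (Ω : Set (Space n)), V) where
  toFun f := ⟨f, by
    have := f.contDiff_ext.continuous.comp
      (continuous_subtype_val (p := fun x => x ∈ closure (Ω : Set (Space n))))
    exact this.congr (ext_apply f)⟩
  map_add' _ _ := rfl
  map_smul' _ _ := rfl
  cont := by
    have h : Continuous fun g : C(closure (Ω : Set (Space n)),
        ContinuousMultilinearMap ℝ (fun _ : Fin 0 => Space n) V) =>
        (⟨_, (continuousMultilinearCurryFin0 ℝ (Space n) V).continuous⟩ : C(_, V)).comp g :=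
      ContinuousMap.continuous_postcomp _
    refine (h.comp (continuous_jet 0)).congr fun f => ?_
    ext x
    exact ext_apply f x

instance : T2Space (SmoothFn Ω V) :=
  T2Space.of_injective_continuous (f := toContinuousMap)
    (fun _ _ h => eq_of_apply fun x => DFunLike.congr_fun h x) toContinuousMap.continuous

variable (Ω V) in
/-- The derivative as a continuous linear map. -/
def DL : SmoothFn Ω V →L[ℝ] SmoothFn Ω (Space n →L[ℝ] V) where
  toLinearMap := D Ω V
  cont := by
    refine continuous_iff.2 fun k => ?_
    have h : Continuous fun g : C(closure (Ω : Set (Space n)),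
        ContinuousMultilinearMap ℝ (fun _ : Fin (k + 1) => Space n) V) =>
        (⟨_, (continuousMultilinearCurryRightEquiv' ℝ k (Space n) V).continuous⟩ :
          C(_, _)).comp g :=
      ContinuousMap.continuous_postcomp _
    refine (h.comp (continuous_jet (k + 1))).congr fun f => ?_
    ext1 x
    refine Eq.trans ?_ (jet_eq (contDiff_fderiv f.contDiff_ext) (D_apply f) k x).symm
    simp only [Function.comp_apply, ContinuousMap.comp_apply, ContinuousMap.coe_mk, jet_apply]
    rw [iteratedFDeriv_succ_eq_comp_right]
    simp

variable (Ω) in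
/-- Pointwise application of a bilinear map. -/
def bil (b : V →L[ℝ] W →L[ℝ] U) : SmoothFn Ω V →ₗ[ℝ] SmoothFn Ω W →ₗ[ℝ] SmoothFn Ω U :=
  LinearMap.mk₂ ℝ
    (fun f g => restrict Ω (fun x => b (f.ext x) (g.ext x))
      ((b.contDiff.comp f.contDiff_ext).clm_apply g.contDiff_ext))
    (fun f f' g => eq_of_apply fun x => by simp [ext_apply])
    (fun c f g => eq_of_apply fun x => by simp [ext_apply])
    (fun f g g' => eq_of_apply fun x => by simp [ext_apply])
    (fun c f g => eq_of_apply fun x => by simp [ext_apply])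

theorem bil_apply (b : V →L[ℝ] W →L[ℝ] U) (f : SmoothFn Ω V) (g : SmoothFn Ω W)
    (x : closure (Ω : Set (Space n))) : bil Ω b f g x = b (f x) (g x) := by
  simp [bil, ext_apply]

section Compact

variable [CompactSpace (closure (Ω : Set (Space n)))]

theorem continuous_norm_jet (k : ℕ) : Continuous fun f : SmoothFn Ω V => ‖jet k f‖ :=
  (continuous_norm (E := C(closure (Ω : Set (Space n)),
    ContinuousMultilinearMap ℝ (fun _ : Fin k => Space n) V))).comp (continuous_jet k)

theorem norm_jet_zero (k : ℕ) : ‖jet k (0 : SmoothFn Ω V)‖ = 0 :=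
  (congrArg norm (map_zero (jetₗ Ω V k))).trans (norm_zero (E := C(closure (Ω : Set (Space n)),
    ContinuousMultilinearMap ℝ (fun _ : Fin k => Space n) V)))

/-- The Leibniz estimate, in sup norms over the compact closure. -/
theorem norm_jet_bil_le (b : V →L[ℝ] W →L[ℝ] U) (f : SmoothFn Ω V) (g : SmoothFn Ω W) (k : ℕ) :
    ‖jet k (bil Ω b f g)‖ ≤
      ‖b‖ * ∑ i ∈ Finset.range (k + 1), (k.choose i : ℝ) * ‖jet i f‖ * ‖jet (k - i) g‖ := by
  rw [ContinuousMap.norm_le _ (by positivity)]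
  intro x
  rw [jet_eq ((b.contDiff.comp f.contDiff_ext).clm_apply g.contDiff_ext) (fun _ => rfl) k x]
  refine (b.norm_iteratedFDeriv_le_of_bilinear f.contDiff_ext g.contDiff_ext x
    (natCast_le_infty k)).trans ?_
  gcongr with i hi
  · exact (jet i f).norm_coe_le_norm x
  · exact (jet (k - i) g).norm_coe_le_norm x

/-- By $b(f,g)-b(f_0,g_0)=b(f-f_0,g)+b(f_0,g-g_0)$, the Leibniz estimate bounds the difference by an
expression continuous in $(f,g)$ that vanishes at $(f_0,g_0)$. -/
theorem continuous_bil (b : V →L[ℝ] W →L[ℝ] U) :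
    Continuous fun p : SmoothFn Ω V × SmoothFn Ω W => bil Ω b p.1 p.2 := by
  refine continuous_iff.2 fun k => continuous_iff_continuousAt.2 fun ⟨f₀, g₀⟩ => ?_
  refine (tendsto_iff_norm_sub_tendsto_zero (E := C(closure (Ω : Set (Space n)),
    ContinuousMultilinearMap ℝ (fun _ : Fin k => Space n) U))).2 ?_
  have hbound : ∀ p : SmoothFn Ω V × SmoothFn Ω W,
      ‖jet k (bil Ω b p.1 p.2) - jet k (bil Ω b f₀ g₀)‖ ≤
      ‖b‖ * ∑ i ∈ Finset.range (k + 1), (k.choose i : ℝ) * ‖jet i (p.1 - f₀)‖ * ‖jet (k - i) p.2‖ +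
      ‖b‖ * ∑ i ∈ Finset.range (k + 1), (k.choose i : ℝ) * ‖jet i f₀‖ * ‖jet (k - i) (p.2 - g₀)‖ := by
    rintro ⟨f, g⟩
    have e : jet k (bil Ω b f g) - jet k (bil Ω b f₀ g₀) =
        jet k (bil Ω b (f - f₀) g) + jet k (bil Ω b f₀ (g - g₀)) := by
      have := (map_add (jetₗ Ω U k) (bil Ω b (f - f₀) g) (bil Ω b f₀ (g - g₀))).symm
      have h2 := (map_sub (jetₗ Ω U k) (bil Ω b f g) (bil Ω b f₀ g₀)).symm
      refine h2.trans (Eq.trans ?_ this.symm)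
      congr 1
      simp
    rw [e]
    exact (norm_add_le (jet k (bil Ω b (f - f₀) g)) (jet k (bil Ω b f₀ (g - g₀)))).trans
      (add_le_add (norm_jet_bil_le b (f - f₀) g k) (norm_jet_bil_le b f₀ (g - g₀) k))
  refine squeeze_zero (fun p => norm_nonneg (jet k (bil Ω b p.1 p.2) - jet k (bil Ω b f₀ g₀))) hbound ?_
  have hc : Continuous fun p : SmoothFn Ω V × SmoothFn Ω W =>
      ‖b‖ * ∑ i ∈ Finset.range (k + 1), (k.choose i : ℝ) * ‖jet i (p.1 - f₀)‖ * ‖jet (k - i) p.2‖ +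
      ‖b‖ * ∑ i ∈ Finset.range (k + 1), (k.choose i : ℝ) * ‖jet i f₀‖ * ‖jet (k - i) (p.2 - g₀)‖ := by
    refine (continuous_const.mul (continuous_finsetSum _ fun i _ => ?_)).add
      (continuous_const.mul (continuous_finsetSum _ fun i _ => ?_))
    · exact (continuous_const.mul ((continuous_norm_jet i).comp
        (continuous_fst.sub continuous_const))).mul ((continuous_norm_jet _).comp continuous_snd)
    · exact continuous_const.mul ((continuous_norm_jet _).comp
        (continuous_snd.sub continuous_const))
  refine hc.tendsto' _ _ ?_
  simp [norm_jet_zero]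

theorem integrableOn_ext (f : SmoothFn Ω V) : IntegrableOn f.ext (Ω : Set (Space n)) :=
  (f.contDiff_ext.continuous.continuousOn.integrableOn_compact
    (isCompact_iff_compactSpace.2 ‹_›)).mono_set subset_closure

theorem measure_lt_top : volume (Ω : Set (Space n)) < ⊤ :=
  (measure_mono subset_closure).trans_lt
    (isCompact_iff_compactSpace.2 ‹CompactSpace (closure (Ω : Set (Space n)))›).measure_lt_top

variable (Ω) in
/-- The integral over `Ω`, as a linear map. -/
def integralₗ : SmoothFn Ω ℝ →ₗ[ℝ] ℝ where
  toFun f := ∫ x in (Ω : Set (Space n)), f.ext x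
  map_add' f g := by
    rw [← integral_add (integrableOn_ext f) (integrableOn_ext g)]
    exact setIntegral_congr_fun Ω.isOpen.measurableSet fun x hx => ext_add f g (subset_closure hx)
  map_smul' c f := by
    rw [RingHom.id_apply, ← integral_smul]
    exact setIntegral_congr_fun Ω.isOpen.measurableSet
      fun x hx => ext_smul c f (subset_closure hx)

variable (Ω) in
/-- The integral over `Ω`. -/
def integral : SmoothFn Ω ℝ →L[ℝ] ℝ where
  toLinearMap := integralₗ Ω
  cont := by
    refine continuous_of_continuousAt_zero (integralₗ Ω) ?_
    rw [ContinuousAt, map_zero]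
    refine squeeze_zero_norm
      (a := fun f => ‖toContinuousMap f‖ * volume.real (Ω : Set (Space n))) (fun f => ?_) ?_
    · refine norm_setIntegral_le_of_norm_le_const measure_lt_top fun x hx => ?_
      rw [ext_apply f ⟨x, subset_closure hx⟩]
      exact (toContinuousMap f).norm_coe_le_norm ⟨x, subset_closure hx⟩
    · have : Continuous fun f : SmoothFn Ω ℝ =>
          ‖toContinuousMap f‖ * volume.real (Ω : Set (Space n)) := by fun_prop
      exact this.tendsto' 0 0 (by simp)

end Compact

end SmoothFn

/-! ### Functions vanishing on the boundary -/

section DefiningFunctions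

variable {n : ℕ} {Ω : Opens (Space n)} {U : Set (Space n)} {ρ : Space n → ℝ}

theorem IsDefiningFunction.contDiffAt (h : IsDefiningFunction Ω U ρ) {x : Space n} (hx : x ∈ U) :
    ContDiffAt ℝ ∞ ρ x := h.2.1.contDiffAt (h.1.mem_nhds hx)

/-- A zero of ρ outside the closure of Ω would be a local minimum of ρ, which the nonvanishing
differential excludes. -/
theorem IsDefiningFunction.mem_frontier_iff (h : IsDefiningFunction Ω U ρ) {x : Space n}
    (hx : x ∈ U) : x ∈ frontier (Ω : Set (Space n)) ↔ ρ x = 0 := by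
  have hc : ContinuousAt ρ x := (h.contDiffAt hx).continuousAt
  have hU : ∀ᶠ y in 𝓝 x, y ∈ U := h.1.mem_nhds hx
  rw [Ω.isOpen.frontier_eq]
  constructor
  · rintro ⟨hcl, hn⟩
    have h0 : 0 ≤ ρ x := not_lt.1 fun hlt => hn ((h.2.2.2 x hx).2 hlt)
    refine le_antisymm (not_lt.1 fun hpos => ?_) h0
    obtain ⟨y, hyΩ, hy, hyU⟩ := (mem_closure_iff_frequently.1 hcl).and_eventually
      ((hc.eventually (lt_mem_nhds hpos)).and hU) |>.exists
    exact lt_asymm hy ((h.2.2.2 y hyU).1 hyΩ)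
  · intro h0
    refine ⟨by_contra fun hcl => ?_, fun hm => (((h.2.2.2 x hx).1 hm).ne h0)⟩
    rw [mem_closure_iff_frequently, not_frequently] at hcl
    refine h.2.2.1 x hx (IsLocalMin.fderiv_eq_zero ?_)
    filter_upwards [hcl, hU] with y hy hyU
    rw [h0]
    exact not_lt.1 fun hlt => hy ((h.2.2.2 y hyU).2 hlt)

/-- A function of class `C¹` that vanishes on the boundary is bounded near a boundary point by
a multiple of the defining function. -/
theorem IsDefiningFunction.exists_abs_le (h : IsDefiningFunction Ω U ρ) {x₀ : Space n}
    (hx₀ : x₀ ∈ U) (hρ₀ : ρ x₀ = 0) {f : Space n → ℝ} (hf : ContDiffAt ℝ 1 f x₀)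
    (hf0 : ∀ x ∈ U, ρ x = 0 → f x = 0) :
    ∃ C : ℝ, 0 ≤ C ∧ ∀ᶠ x in 𝓝 x₀, |f x| ≤ C * |ρ x| := by
  -- Along a transversal direction `e`, ρ changes at speed close to 1, so from `x` a zero of ρ is
  -- reached within time `2 * |ρ x|`. There `f` vanishes, and its Lipschitz bound gives the
  -- estimate.
  obtain ⟨e, he⟩ : ∃ e, fderiv ℝ ρ x₀ e = 1 := by
    obtain ⟨v, hv⟩ : ∃ v, fderiv ℝ ρ x₀ v ≠ 0 := by
      by_contra! hcon
      exact h.2.2.1 x₀ hx₀ (ContinuousLinearMap.ext hcon)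
    exact ⟨(fderiv ℝ ρ x₀ v)⁻¹ • v, by simp [hv]⟩
  have hst : HasStrictFDerivAt ρ (fderiv ℝ ρ x₀) x₀ :=
    (h.contDiffAt hx₀).hasStrictFDerivAt (by simp)
  obtain ⟨K, s, hs, hK⟩ := hf.exists_lipschitzOnWith
  -- This constant makes the linearization error along `t • e` at most `|t| / 2`; the summand 1
  -- avoids dividing by `‖e‖`.
  have hc : (0 : ℝ) < 1 / (2 * (‖e‖ + 1)) := by positivity
  have hb := hst.isLittleO.bound hc
  rw [nhds_prod_eq] at hb
  obtain ⟨s', hs', hb⟩ := mem_prod_self_iff.1 hb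
  obtain ⟨r, hr, hball⟩ := Metric.mem_nhds_iff.1 (inter_mem (inter_mem hs hs') (h.1.mem_nhds hx₀))
  have hev : ∀ᶠ x in 𝓝 x₀, 2 * |ρ x| * ‖e‖ < r / 2 := by
    have hcont : ContinuousAt (fun x => 2 * |ρ x| * ‖e‖) x₀ :=
      (continuousAt_const.mul (h.contDiffAt hx₀).continuousAt.abs).mul continuousAt_const
    refine hcont.eventually (gt_mem_nhds ?_)
    simp [hρ₀, hr]
  refine ⟨K * (2 * ‖e‖), by positivity, ?_⟩
  filter_upwards [hev, Metric.ball_mem_nhds x₀ (half_pos hr)] with x hx hxb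
  have hin : ∀ t : ℝ, |t| ≤ 2 * |ρ x| → x + t • e ∈ Metric.ball x₀ r := by
    intro t ht
    rw [Metric.mem_ball, dist_eq_norm] at hxb ⊢
    have : ‖t • e‖ ≤ 2 * |ρ x| * ‖e‖ := by
      rw [norm_smul, Real.norm_eq_abs]
      gcongr
    calc ‖x + t • e - x₀‖ = ‖(x - x₀) + t • e‖ := by congr 1; abel
      _ ≤ ‖x - x₀‖ + ‖t • e‖ := norm_add_le _ _
      _ < r := by linarith
  have hx0 : x ∈ Metric.ball x₀ r := by simpa using hin 0 (by simp)
  have hest : ∀ t : ℝ, |t| ≤ 2 * |ρ x| → |ρ (x + t • e) - ρ x - t| ≤ |t| / 2 := by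
    intro t ht
    have h1 := hb (mk_mem_prod (hball (hin t ht)).1.2 (hball hx0).1.2)
    simp only [mem_ofPred_eq, add_sub_cancel_left, map_smul, he, smul_eq_mul, mul_one, norm_smul,
      Real.norm_eq_abs] at h1
    refine h1.trans ?_
    rw [div_mul_eq_mul_div, one_mul, div_le_div_iff₀ (by positivity) (by positivity)]
    nlinarith [abs_nonneg t, norm_nonneg e]
  have habs := abs_nonneg (ρ x)
  have hτ : |(2 * |ρ x|)| = 2 * |ρ x| := abs_of_nonneg (by positivity)
  -- At times `± 2 * |ρ x|` the increment of ρ differs from the time by at most `|ρ x|`, so ρ is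
  -- nonpositive at one end and nonnegative at the other.
  obtain ⟨t, ht, ht0⟩ : ∃ t ∈ Icc (-(2 * |ρ x|)) (2 * |ρ x|), ρ (x + t • e) = 0 := by
    refine intermediate_value_Icc (f := fun t : ℝ => ρ (x + t • e)) (by linarith) ?_ ⟨?_, ?_⟩
    · refine h.2.1.continuousOn.comp (by fun_prop) fun t ht => (hball (hin t ?_)).2
      exact abs_le.2 ht
    · have h1 := hest (-(2 * |ρ x|)) (by rw [abs_neg, hτ])
      rw [abs_neg, hτ] at h1
      have := abs_le.1 h1
      have := le_abs_self (ρ x)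
      linarith
    · have h1 := hest (2 * |ρ x|) hτ.le
      rw [hτ] at h1
      have := abs_le.1 h1
      have := neg_abs_le (ρ x)
      linarith
  have ht' := abs_le.2 ht
  have hmem := hball (hin t ht')
  have hd := hK.dist_le_mul _ (hball hx0).1.1 _ hmem.1.1
  rw [hf0 _ hmem.2 ht0, dist_zero_right, Real.norm_eq_abs, dist_eq_norm, sub_add_cancel_left,
    norm_neg, norm_smul, Real.norm_eq_abs] at hd
  refine hd.trans ?_
  have : |t| * ‖e‖ ≤ 2 * |ρ x| * ‖e‖ := by gcongr
  calc (K : ℝ) * (|t| * ‖e‖) ≤ K * (2 * |ρ x| * ‖e‖) := by gcongr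
    _ = K * (2 * ‖e‖) * |ρ x| := by ring

/-- A function of class `C¹` that vanishes on the boundary has vanishing tangential derivatives
there. -/
theorem IsDefiningFunction.fderiv_apply_eq_zero (h : IsDefiningFunction Ω U ρ) {x₀ : Space n}
    (hx₀ : x₀ ∈ U) (hρ₀ : ρ x₀ = 0) {f : Space n → ℝ} (hf : ContDiffAt ℝ 1 f x₀)
    (hf0 : ∀ x ∈ U, ρ x = 0 → f x = 0) {w : Space n} (hw : fderiv ℝ ρ x₀ w = 0) :
    fderiv ℝ f x₀ w = 0 := by
  obtain ⟨C, hC, hle⟩ := h.exists_abs_le hx₀ hρ₀ hf hf0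
  have hl : Tendsto (fun t : ℝ => x₀ + t • w) (𝓝 0) (𝓝 x₀) :=
    Continuous.tendsto' (by fun_prop) 0 _ (by simp)
  have h1 := ((h.contDiffAt hx₀).differentiableAt (by simp)).hasFDerivAt.hasLineDerivAt w
  have h2 := (hf.differentiableAt (by simp)).hasFDerivAt.hasLineDerivAt w
  have h3 : HasLineDerivAt ℝ f 0 x₀ w := by
    unfold HasLineDerivAt at h1 ⊢
    rw [hw] at h1
    rw [hasDerivAt_iff_isLittleO_nhds_zero] at h1 ⊢
    simp only [zero_add, zero_smul, add_zero, hρ₀, hf0 x₀ hx₀ hρ₀, sub_zero, smul_zero] at h1 ⊢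
    -- Since `w` is tangential, ρ is $o(t)$ along the line, and $|f|\le C|\rho|$.
    refine Asymptotics.IsBigO.trans_isLittleO (Asymptotics.IsBigO.of_bound C ?_) h1
    filter_upwards [hl.eventually hle] with t ht
    exact ht
  exact h2.unique h3

theorem IsDefiningFunction.contDiffAt_normal (h : IsDefiningFunction Ω U ρ) (u : VectField Ω)
    {x : Space n} (hx : x ∈ U) : ContDiffAt ℝ ∞ (fun y => fderiv ℝ ρ y (u.ext y)) x :=
  ((h.contDiffAt hx).fderiv_right (m := ∞) (by simp)).clm_apply u.contDiff_ext.contDiffAt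

theorem IsTangentToBoundary.normal_eq_zero {u : VectField Ω} (hu : IsTangentToBoundary Ω u)
    (h : IsDefiningFunction Ω U ρ) : ∀ x ∈ U, ρ x = 0 → fderiv ℝ ρ x (u.ext x) = 0 := by
  intro x hx h0
  have hfr := (h.mem_frontier_iff hx).2 h0
  have := hu U ρ h ⟨x, frontier_subset_closure hfr⟩ hfr hx
  rwa [← SmoothFn.ext_apply] at this

end DefiningFunctions

/-! ### The Lie bracket preserves `SVect Ω` -/

section Bracket

variable {n : ℕ} {Ω : Opens (Space n)}

theorem bracket_ext (u v : VectField Ω) {x : Space n} (hx : x ∈ closure (Ω : Set (Space n))) :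
    (bracket Ω u v).ext x = fderiv ℝ v.ext x (u.ext x) - fderiv ℝ u.ext x (v.ext x) :=
  SmoothFn.ext_restrict _ hx

theorem fderiv_normal {ρ : Space n → ℝ} {x : Space n} (hρ : ContDiffAt ℝ ∞ ρ x)
    {v : Space n → Space n} (hv : ContDiff ℝ ∞ v) (w : Space n) :
    fderiv ℝ (fun y => fderiv ℝ ρ y (v y)) x w =
      fderiv ℝ ρ x (fderiv ℝ v x w) + fderiv ℝ (fderiv ℝ ρ) x w (v x) := by
  rw [fderiv_clm_apply ((hρ.fderiv_right (m := ∞) (by simp)).differentiableAt (by simp))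
    (hv.differentiable (by simp) x)]
  simp

theorem isSymmSndFDerivAt_of_smooth {F : Type*} [NormedAddCommGroup F] [NormedSpace ℝ F]
    {f : Space n → F} {x : Space n} (hf : ContDiffAt ℝ ∞ f x) : IsSymmSndFDerivAt ℝ f x :=
  hf.isSymmSndFDerivAt (by
    rw [minSmoothness_of_isRCLikeNormedField]
    exact WithTop.coe_le_coe.2 le_top)

/-- $d\rho(v)$ vanishes on the boundary, hence so does its derivative along the tangential field
$u$; likewise with $u,v$ exchanged. In the difference the second derivatives of ρ cancel by
symmetry, leaving $d\rho([u,v])=0$. -/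
theorem isTangentToBoundary_bracket {u v : VectField Ω} (hu : IsTangentToBoundary Ω u)
    (hv : IsTangentToBoundary Ω v) : IsTangentToBoundary Ω (bracket Ω u v) := by
  intro U ρ h x hfr hxU
  have h0 := (h.mem_frontier_iff hxU).1 hfr
  have hρ := h.contDiffAt hxU
  have h1 := h.fderiv_apply_eq_zero hxU h0 ((h.contDiffAt_normal v hxU).of_le (by simp))
    (hv.normal_eq_zero h) (hu.normal_eq_zero h x hxU h0)
  have h2 := h.fderiv_apply_eq_zero hxU h0 ((h.contDiffAt_normal u hxU).of_le (by simp))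
    (hu.normal_eq_zero h) (hv.normal_eq_zero h x hxU h0)
  rw [fderiv_normal hρ v.contDiff_ext] at h1
  rw [fderiv_normal hρ u.contDiff_ext] at h2
  rw [← SmoothFn.ext_apply, bracket_ext u v x.2, map_sub]
  have := (isSymmSndFDerivAt_of_smooth hρ).eq (u.ext x) (v.ext x)
  linarith

/-- The trace of an endomorphism of `ℝⁿ`. -/
def traceCLM (n : ℕ) : (Space n →L[ℝ] Space n) →L[ℝ] ℝ :=
  ∑ i : Fin n, (EuclideanSpace.proj i : Space n →L[ℝ] ℝ) ∘L
    ContinuousLinearMap.apply ℝ (Space n) (EuclideanSpace.single i (1 : ℝ))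

theorem traceCLM_apply (A : Space n →L[ℝ] Space n) :
    traceCLM n A = ∑ i, A (EuclideanSpace.single i 1) i := by
  simp [traceCLM]

theorem apply_eq_sum {F : Type*} [NormedAddCommGroup F] [NormedSpace ℝ F] (A : Space n →L[ℝ] F)
    (v : Space n) : A v = ∑ j, v j • A (EuclideanSpace.single j 1) := by
  conv_lhs => rw [← (EuclideanSpace.basisFun (Fin n) ℝ).sum_repr v]
  simp

theorem traceCLM_comp_comm (A B : Space n →L[ℝ] Space n) :
    traceCLM n (A ∘L B) = traceCLM n (B ∘L A) := by
  simp only [traceCLM_apply, ContinuousLinearMap.comp_apply]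
  have h : ∀ A B : Space n →L[ℝ] Space n, ∀ i, A (B (EuclideanSpace.single i 1)) i =
      ∑ j, B (EuclideanSpace.single i 1) j * A (EuclideanSpace.single j 1) i := by
    intro A B i
    rw [apply_eq_sum A (B (EuclideanSpace.single i 1))]
    simp
  simp only [h]
  rw [Finset.sum_comm]
  simp only [mul_comm]

theorem divergence_eq (u : VectField Ω) (x : closure (Ω : Set (Space n))) :
    divergence Ω u x = traceCLM n (fderiv ℝ u.ext x) := by
  rw [traceCLM_apply]
  rfl

theorem trace_fderiv_fderiv_apply {v : Space n → Space n} (hv : ContDiff ℝ ∞ v) {x : Space n}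
    (hx : x ∈ Ω) (hdiv : ∀ y ∈ Ω, traceCLM n (fderiv ℝ v y) = 0) (w : Space n) :
    traceCLM n ((fderiv ℝ (fderiv ℝ v) x).flip w) = 0 := by
  have h1 : (fderiv ℝ (fderiv ℝ v) x).flip w = fderiv ℝ (fderiv ℝ v) x w := by
    ext1 e
    exact (isSymmSndFDerivAt_of_smooth hv.contDiffAt).eq e w
  have h2 : HasFDerivAt (fun y => traceCLM n (fderiv ℝ v y))
      (traceCLM n ∘L fderiv ℝ (fderiv ℝ v) x) x :=
    (traceCLM n).hasFDerivAt.comp x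
      ((SmoothFn.contDiff_fderiv hv).differentiable (by simp) x).hasFDerivAt
  have h3 : HasFDerivAt (fun y => traceCLM n (fderiv ℝ v y)) (0 : Space n →L[ℝ] ℝ) x :=
    (hasFDerivAt_const (0 : ℝ) x).congr_of_eventuallyEq
      (eventuallyEq_of_mem (Ω.isOpen.mem_nhds hx) hdiv)
  rw [h1]
  exact DFunLike.congr_fun (h2.unique h3) w

/-- The trace of $D[u,v]$ consists of derivatives of $\operatorname{div}u$ and
$\operatorname{div}v$, which vanish, and of the trace of a commutator. The computation is done on Ω,
where the extensions are divergence free in a neighbourhood, and extended to the closure by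
continuity. -/
theorem divergence_bracket {u v : VectField Ω} (hu : ∀ x, divergence Ω u x = 0)
    (hv : ∀ x, divergence Ω v x = 0) (x : closure (Ω : Set (Space n))) :
    divergence Ω (bracket Ω u v) x = 0 := by
  have hu' : ∀ y ∈ Ω, traceCLM n (fderiv ℝ u.ext y) = 0 := fun y hy => by
    rw [← divergence_eq u ⟨y, subset_closure hy⟩, hu]
  have hv' : ∀ y ∈ Ω, traceCLM n (fderiv ℝ v.ext y) = 0 := fun y hy => by
    rw [← divergence_eq v ⟨y, subset_closure hy⟩, hv]
  rw [divergence_eq]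
  refine EqOn.closure (s := (Ω : Set (Space n)))
    (f := fun y => traceCLM n (fderiv ℝ (bracket Ω u v).ext y)) (g := fun _ => (0 : ℝ))
    (fun y hy => ?_)
    ((traceCLM n).continuous.comp ((bracket Ω u v).contDiff_ext.continuous_fderiv (by simp)))
    continuous_const x.2
  have hsu := u.contDiff_ext
  have hsv := v.contDiff_ext
  have e := SmoothFn.fderiv_ext_eq (f := bracket Ω u v)
    (g := fun x => fderiv ℝ v.ext x (u.ext x) - fderiv ℝ u.ext x (v.ext x))
    (((SmoothFn.contDiff_fderiv hsv).clm_apply hsu).sub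
      ((SmoothFn.contDiff_fderiv hsu).clm_apply hsv)) (fun _ => rfl) ⟨y, subset_closure hy⟩
  have du := (hsu.differentiable (by simp)) y
  have dv := (hsv.differentiable (by simp)) y
  have ddu := ((SmoothFn.contDiff_fderiv hsu).differentiable (by simp)) y
  have ddv := ((SmoothFn.contDiff_fderiv hsv).differentiable (by simp)) y
  simp only at e ⊢
  rw [e, fderiv_fun_sub (ddv.clm_apply du) (ddu.clm_apply dv), fderiv_clm_apply ddv du,
    fderiv_clm_apply ddu dv, map_sub, map_add, map_add,
    trace_fderiv_fderiv_apply hsu hy hu', trace_fderiv_fderiv_apply hsv hy hv',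
    traceCLM_comp_comm]
  simp

theorem bracket_mem_SVect (u v : SVect Ω) : bracket Ω u v ∈ SVect Ω :=
  ⟨divergence_bracket u.2.1 v.2.1, isTangentToBoundary_bracket u.2.2 v.2.2⟩

end Bracket

/-! ### Orthogonality to gradients -/

section Divergence

variable {n : ℕ} {Ω : Opens (Space n)}

theorem integrable_fderiv_apply {g : Space n → ℝ} (hg : ContDiff ℝ ∞ g) (hgs : HasCompactSupport g)
    {u : Space n → Space n} (hu : Continuous u) : Integrable fun x => fderiv ℝ g x (u x) := by
  refine ((hg.continuous_fderiv (by simp)).clm_apply hu).integrable_of_hasCompactSupport ?_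
  exact (hgs.fderiv (𝕜 := ℝ)).mono fun x hx hx0 => hx (by simp [hx0])

/-- Integration by parts in each coordinate. The divergence is constrained only on the support of
`g`, since an extension of a field need not be divergence free outside Ω. -/
theorem integral_fderiv_apply_eq_zero {g : Space n → ℝ} (hg : ContDiff ℝ ∞ g)
    (hgs : HasCompactSupport g) {u : Space n → Space n} (hu : ContDiff ℝ ∞ u)
    (hdiv : ∀ x ∈ tsupport g, traceCLM n (fderiv ℝ u x) = 0) :
    ∫ x, fderiv ℝ g x (u x) = 0 := by
  have hui : ∀ i, ContDiff ℝ ∞ fun x => u x i := fun i =>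
    (EuclideanSpace.proj i : Space n →L[ℝ] ℝ).contDiff.comp hu
  have hgd := hg.differentiable (by simp)
  have i1 : ∀ i, Integrable fun x => fderiv ℝ (fun x => u x i) x (EuclideanSpace.single i 1) * g x :=
    fun i => ((((hui i).continuous_fderiv (by simp)).clm_apply continuous_const).mul
      hg.continuous).integrable_of_hasCompactSupport hgs.mul_left
  have i2 : ∀ i, Integrable fun x => u x i * fderiv ℝ g x (EuclideanSpace.single i 1) :=
    fun i => ((hui i).continuous.mul ((hg.continuous_fderiv (by simp)).clm_apply
      continuous_const)).integrable_of_hasCompactSupport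
      (hgs.fderiv_apply (𝕜 := ℝ) (EuclideanSpace.single i 1)).mul_left
  have i3 : ∀ i, Integrable fun x => u x i * g x := fun i =>
    ((hui i).continuous.mul hg.continuous).integrable_of_hasCompactSupport hgs.mul_left
  calc ∫ x, fderiv ℝ g x (u x)
      = ∫ x, ∑ i, u x i * fderiv ℝ g x (EuclideanSpace.single i 1) := by
        refine integral_congr_ae (ae_of_all _ fun x => ?_)
        simp only
        rw [apply_eq_sum (fderiv ℝ g x) (u x)]
        simp
    _ = ∑ i, -∫ x, fderiv ℝ (fun x => u x i) x (EuclideanSpace.single i 1) * g x := by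
        rw [integral_finsetSum _ fun i _ => i2 i]
        refine Finset.sum_congr rfl fun i _ => ?_
        exact integral_mul_fderiv_eq_neg_fderiv_mul_of_integrable (i1 i) (i2 i) (i3 i)
          (fun x _ => (hui i).differentiable (by simp) x) (fun x _ => hgd x)
    _ = -∫ x, ∑ i, fderiv ℝ (fun x => u x i) x (EuclideanSpace.single i 1) * g x := by
        rw [integral_finsetSum _ fun i _ => i1 i, Finset.sum_neg_distrib]
    _ = -∫ x : Space n, (0 : ℝ) := by
        congr 1
        refine integral_congr_ae (ae_of_all _ fun x => ?_)
        simp only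
        rw [← Finset.sum_mul]
        by_cases hx : x ∈ tsupport g
        · have e : ∀ i, fderiv ℝ (fun x => u x i) x (EuclideanSpace.single i 1) =
              fderiv ℝ u x (EuclideanSpace.single i 1) i := fun i => by
            have := ((EuclideanSpace.proj i : Space n →L[ℝ] ℝ).hasFDerivAt.comp x
              (hu.differentiable (by simp) x).hasFDerivAt).fderiv
            exact DFunLike.congr_fun this (EuclideanSpace.single i 1)
          simp only [e]
          rw [← traceCLM_apply, hdiv x hx, zero_mul]
        · rw [image_eq_zero_of_notMem_tsupport hx, mul_zero]
    _ = 0 := by simp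

variable {u : VectField Ω}

theorem setIntegral_fderiv_apply_eq_zero_of_tsupport_subset (hu : ∀ x, divergence Ω u x = 0)
    {g : Space n → ℝ} (hg : ContDiff ℝ ∞ g) (hgs : HasCompactSupport g)
    (hgΩ : tsupport g ⊆ Ω) : ∫ x in (Ω : Set (Space n)), fderiv ℝ g x (u.ext x) = 0 := by
  rw [setIntegral_eq_integral_of_forall_compl_eq_zero]
  · refine integral_fderiv_apply_eq_zero hg hgs u.contDiff_ext fun x hx => ?_
    rw [← divergence_eq u ⟨x, subset_closure (hgΩ hx)⟩, hu]
  · intro x hx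
    have : fderiv ℝ g x = 0 :=
      image_eq_zero_of_notMem_tsupport fun hx' => hx (hgΩ (tsupport_fderiv_subset ℝ hx'))
    simp [this]

/-- A smooth cutoff function, `1` on `(-∞, -2]` and `0` on `[-1, ∞)`. -/
def cutoff (s : ℝ) : ℝ := Real.smoothTransition (-s - 1)

theorem contDiff_cutoff : ContDiff ℝ ∞ cutoff :=
  Real.smoothTransition.contDiff.comp (contDiff_neg.sub contDiff_const)

theorem cutoff_of_le {s : ℝ} (h : s ≤ -2) : cutoff s = 1 :=
  Real.smoothTransition.one_of_one_le (by linarith)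

theorem cutoff_of_ge {s : ℝ} (h : -1 ≤ s) : cutoff s = 0 :=
  Real.smoothTransition.zero_of_nonpos (by linarith)

theorem abs_cutoff_le (s : ℝ) : |cutoff s| ≤ 1 := by
  rw [abs_of_nonneg (show 0 ≤ cutoff s from Real.smoothTransition.nonneg _)]
  exact Real.smoothTransition.le_one _

theorem deriv_cutoff_of_lt {s : ℝ} (h : s < -2) : deriv cutoff s = 0 := by
  have : cutoff =ᶠ[𝓝 s] fun _ => 1 := eventuallyEq_of_mem (Iio_mem_nhds h) fun t ht =>
    cutoff_of_le (le_of_lt ht)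
  rw [this.deriv_eq, deriv_const]

theorem deriv_cutoff_of_gt {s : ℝ} (h : -1 < s) : deriv cutoff s = 0 := by
  have : cutoff =ᶠ[𝓝 s] fun _ => 0 := eventuallyEq_of_mem (Ioi_mem_nhds h) fun t ht =>
    cutoff_of_ge (le_of_lt ht)
  rw [this.deriv_eq, deriv_const]

/-- The bound on $s\chi'(s)$ is invariant under rescaling of $s$, so it is uniform over the cutoffs
$\chi((k+1)\rho)$. -/
theorem exists_deriv_cutoff_mul_le : ∃ M : ℝ, 0 ≤ M ∧ ∀ s, |deriv cutoff s * s| ≤ M := by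
  have hc : Continuous fun s => deriv cutoff s * s :=
    (contDiff_cutoff.continuous_deriv (by simp)).mul continuous_id
  obtain ⟨M, hM⟩ := (isCompact_Icc (a := (-2 : ℝ)) (b := -1)).exists_bound_of_continuousOn
    hc.continuousOn
  refine ⟨max M 0, le_max_right _ _, fun s => ?_⟩
  by_cases hs : s ∈ Icc (-2 : ℝ) (-1)
  · exact (hM s hs).trans (le_max_left _ _)
  · have : deriv cutoff s = 0 := by
      rw [mem_Icc, not_and_or, not_le, not_le] at hs
      exact hs.elim deriv_cutoff_of_lt deriv_cutoff_of_gt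
    simp [this]

/-- Multiplying `f` by $\chi((k+1)\rho)$ makes its support compact in Ω, where the previous case
applies. The error term contains $(k+1)\chi'((k+1)\rho)\,d\rho(u)$; tangency gives $|d\rho(u)|\le
C|\rho|$, so it stays bounded, and at each point of Ω it is eventually zero. Dominated convergence
concludes. -/
theorem exists_mem_nhds_setIntegral_eq_zero_of_mem_frontier (hs : HasSmoothBoundary Ω)
    (hu : u ∈ SVect Ω) {x₀ : Space n} (hx₀ : x₀ ∈ frontier (Ω : Set (Space n))) :
    ∃ N ∈ 𝓝 x₀, ∀ f : Space n → ℝ, ContDiff ℝ ∞ f → HasCompactSupport f → tsupport f ⊆ N →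
      ∫ x in (Ω : Set (Space n)), fderiv ℝ f x (u.ext x) = 0 := by
  obtain ⟨U, ρ, hxU, hρ⟩ := hs x₀ hx₀
  obtain ⟨C, hC, hle⟩ := hρ.exists_abs_le hxU ((hρ.mem_frontier_iff hxU).1 hx₀)
    ((hρ.contDiffAt_normal u hxU).of_le (by simp)) (hu.2.normal_eq_zero hρ)
  obtain ⟨M, hM, hMle⟩ := exists_deriv_cutoff_mul_le
  refine ⟨_, inter_mem hle (hρ.1.mem_nhds hxU), fun f hf hfs hfN => ?_⟩
  have hfU : tsupport f ⊆ U := fun x hx => (hfN hx).2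
  let g : ℕ → Space n → ℝ := fun k x => f x * cutoff (((k : ℝ) + 1) * ρ x)
  have hgd : ∀ k, ∀ x ∈ U, fderiv ℝ (g k) x (u.ext x) =
      cutoff (((k : ℝ) + 1) * ρ x) * fderiv ℝ f x (u.ext x) +
        f x * (deriv cutoff (((k : ℝ) + 1) * ρ x) * (((k : ℝ) + 1) *
          fderiv ℝ ρ x (u.ext x))) := by
    intro k x hx
    have h1 := (hf.differentiable (by simp) x).hasFDerivAt
    have h2 := (((hρ.contDiffAt hx).differentiableAt (by simp)).hasFDerivAt.const_mul
      ((k : ℝ) + 1))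
    have h3 : HasDerivAt cutoff (deriv cutoff (((k : ℝ) + 1) * ρ x)) (((k : ℝ) + 1) * ρ x) :=
      (contDiff_cutoff.differentiable (by simp) _).hasDerivAt
    have h4 := (h1.mul (h3.comp_hasFDerivAt x h2)).fderiv
    have h5 := DFunLike.congr_fun h4 (u.ext x)
    refine h5.trans ?_
    simp
    ring
  have hg : ∀ k, ContDiff ℝ ∞ (g k) := by
    intro k
    refine contDiff_iff_contDiffAt.2 fun x => ?_
    by_cases hx : x ∈ tsupport f
    · exact hf.contDiffAt.mul (contDiff_cutoff.contDiffAt.comp x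
        (contDiffAt_const.mul (hρ.contDiffAt (hfU hx))))
    · refine (contDiffAt_const (c := (0 : ℝ))).congr_of_eventuallyEq ?_
      filter_upwards [notMem_tsupport_iff_eventuallyEq.1 hx] with y hy
      simp [g, hy]
  have hgs : ∀ k, HasCompactSupport (g k) := fun k => hfs.mul_right
  have hgΩ : ∀ k, tsupport (g k) ⊆ Ω := by
    intro k
    have hk : (0 : ℝ) < (k : ℝ) + 1 := by positivity
    -- ρ is continuous only on `U`; intersecting with the closed set `tsupport f ⊆ U` makes the
    -- sublevel set closed in the whole space.
    have hcl : IsClosed (tsupport f ∩ ρ ⁻¹' Iic (-(((k : ℝ) + 1)⁻¹))) :=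
      (hρ.2.1.continuousOn.mono hfU).preimage_isClosed_of_isClosed (isClosed_tsupport f) isClosed_Iic
    have hsub : Function.support (g k) ⊆ tsupport f ∩ ρ ⁻¹' Iic (-(((k : ℝ) + 1)⁻¹)) := by
      refine fun x hx => ⟨?_, ?_⟩
      · exact subset_tsupport f fun h0 => hx (by simp [g, h0])
      · by_contra hn
        refine hx ?_
        simp only [mem_preimage, mem_Iic, not_le] at hn
        have : cutoff (((k : ℝ) + 1) * ρ x) = 0 := by
          refine cutoff_of_ge ?_
          have := mul_lt_mul_of_pos_left hn hk
          rw [mul_neg, mul_inv_cancel₀ hk.ne'] at this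
          exact this.le
        simp [g, this]
    refine (closure_minimal hsub hcl).trans fun x hx => ?_
    refine (hρ.2.2.2 x (hfU hx.1)).2 (lt_of_le_of_lt hx.2 ?_)
    rw [neg_lt_zero]
    positivity
  have hlim : Tendsto (fun k => ∫ x in (Ω : Set (Space n)), fderiv ℝ (g k) x (u.ext x)) atTop
      (𝓝 (∫ x in (Ω : Set (Space n)), fderiv ℝ f x (u.ext x))) := by
    have hzero : ∀ x, x ∉ tsupport f → fderiv ℝ f x = 0 ∧ ∀ k, fderiv ℝ (g k) x = 0 := by
      intro x hx
      refine ⟨image_eq_zero_of_notMem_tsupport fun h => hx (tsupport_fderiv_subset ℝ h),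
        fun k => ?_⟩
      have : g k =ᶠ[𝓝 x] fun _ => 0 := by
        filter_upwards [notMem_tsupport_iff_eventuallyEq.1 hx] with y hy
        simp [g, hy]
      rw [this.fderiv_eq]
      simp
    refine tendsto_integral_of_dominated_convergence
      (fun x => |fderiv ℝ f x (u.ext x)| + |f x| * (C * M)) (fun k => ?_) ?_ (fun k => ?_) ?_
    · exact (((hg k).continuous_fderiv (by simp)).clm_apply
        u.contDiff_ext.continuous).aestronglyMeasurable
    · refine Integrable.integrableOn (Integrable.add ?_ (Integrable.mul_const ?_ _))
      · exact (integrable_fderiv_apply hf hfs u.contDiff_ext.continuous).abs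
      · exact (hf.continuous.integrable_of_hasCompactSupport hfs).abs
    · refine ae_of_all _ fun x => ?_
      by_cases hx : x ∈ tsupport f
      · rw [hgd k x (hfU hx), Real.norm_eq_abs]
        refine (abs_add_le _ _).trans (add_le_add ?_ ?_)
        · rw [abs_mul]
          exact mul_le_of_le_one_left (abs_nonneg _) (abs_cutoff_le _)
        · rw [abs_mul]
          gcongr
          have h1 : |fderiv ℝ ρ x (u.ext x)| ≤ C * |ρ x| := (hfN hx).1
          have h2 := hMle (((k : ℝ) + 1) * ρ x)
          rw [abs_mul] at h2 ⊢
          have hk : (0 : ℝ) ≤ (k : ℝ) + 1 := by positivity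
          rw [abs_mul, abs_of_nonneg hk] at h2 ⊢
          calc |deriv cutoff (((k : ℝ) + 1) * ρ x)| * (((k : ℝ) + 1) * |fderiv ℝ ρ x (u.ext x)|)
              ≤ |deriv cutoff (((k : ℝ) + 1) * ρ x)| * (((k : ℝ) + 1) * (C * |ρ x|)) := by gcongr
            _ = C * (|deriv cutoff (((k : ℝ) + 1) * ρ x)| * (((k : ℝ) + 1) * |ρ x|)) := by ring
            _ ≤ C * M := by gcongr
      · rw [(hzero x hx).2 k]
        simp only [zero_apply, norm_zero]
        positivity
    · refine (ae_restrict_iff' Ω.isOpen.measurableSet).2 (ae_of_all _ fun x hxΩ => ?_)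
      by_cases hx : x ∈ tsupport f
      · have hneg : ρ x < 0 := (hρ.2.2.2 x (hfU hx)).1 hxΩ
        have hev : ∀ᶠ k : ℕ in atTop, ((k : ℝ) + 1) * ρ x < -2 :=
          ((tendsto_natCast_atTop_atTop.atTop_add tendsto_const_nhds).atTop_mul_const_of_neg
            hneg).eventually_lt_atBot _
        refine tendsto_const_nhds.congr' ?_
        filter_upwards [hev] with k hk
        rw [hgd k x (hfU hx), cutoff_of_le hk.le, deriv_cutoff_of_lt hk]
        simp
      · simp [(hzero x hx).1, (hzero x hx).2]
  refine tendsto_nhds_unique hlim (tendsto_const_nhds.congr fun k => ?_)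
  exact (setIntegral_fderiv_apply_eq_zero_of_tsupport_subset hu.1 (hg k) (hgs k) (hgΩ k)).symm

/-- A divergence-free vector field tangent to the boundary is orthogonal to the gradients. -/
theorem setIntegral_fderiv_apply_eq_zero (hb : Bornology.IsBounded (Ω : Set (Space n)))
    (hs : HasSmoothBoundary Ω) (hu : u ∈ SVect Ω) {f : Space n → ℝ} (hf : ContDiff ℝ ∞ f) :
    ∫ x in (Ω : Set (Space n)), fderiv ℝ f x (u.ext x) = 0 := by
  have hloc : ∀ x ∈ closure (Ω : Set (Space n)), ∃ N : Set (Space n), N ∈ 𝓝 x ∧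
      ∀ f : Space n → ℝ, ContDiff ℝ ∞ f → HasCompactSupport f → tsupport f ⊆ N →
        ∫ x in (Ω : Set (Space n)), fderiv ℝ f x (u.ext x) = 0 := by
    intro x hx
    by_cases hxΩ : x ∈ Ω
    · exact ⟨Ω, Ω.isOpen.mem_nhds hxΩ, fun f hf hfs hfN =>
        setIntegral_fderiv_apply_eq_zero_of_tsupport_subset hu.1 hf hfs hfN⟩
    · exact exists_mem_nhds_setIntegral_eq_zero_of_mem_frontier hs hu
        (by rw [Ω.isOpen.frontier_eq]; exact ⟨hx, hxΩ⟩)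
  choose! N hN hloc using hloc
  -- The unit balls serve only to give the functions of the partition of unity compact support.
  obtain ⟨t, htcl, htcov⟩ := hb.isCompact_closure.elim_nhds_subcover
    (fun x => interior (N x) ∩ Metric.ball x 1)
    (fun x hx => inter_mem (interior_mem_nhds.2 (hN x hx)) (Metric.ball_mem_nhds x one_pos))
  obtain ⟨φ, hφ⟩ := SmoothPartitionOfUnity.exists_isSubordinate
    (modelWithCornersSelf ℝ (Space n)) (isClosed_closure (s := (Ω : Set (Space n))))
    (fun i : t => interior (N i) ∩ Metric.ball (i : Space n) 1)
    (fun i => isOpen_interior.inter Metric.isOpen_ball) (fun x hx => by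
      obtain ⟨i, hi, hxi⟩ := mem_iUnion₂.1 (htcov hx)
      exact mem_iUnion.2 ⟨⟨i, hi⟩, hxi⟩)
  have hφs : ∀ i, ContDiff ℝ ∞ (φ i) := fun i => (φ i).contMDiff.contDiff
  have hφc : ∀ i, HasCompactSupport (φ i) := fun i =>
    (isCompact_closedBall (i : Space n) 1).of_isClosed_subset (isClosed_tsupport _)
      (((hφ i).trans inter_subset_right).trans Metric.ball_subset_closedBall)
  have hsm : ∀ i, ContDiff ℝ ∞ fun x => φ i x * f x := fun i => (hφs i).mul hf
  have hcs : ∀ i, HasCompactSupport fun x => φ i x * f x := fun i => (hφc i).mul_right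
  have hsum : EqOn (fun x => fderiv ℝ f x (u.ext x))
      (fun x => ∑ i, fderiv ℝ (fun x => φ i x * f x) x (u.ext x)) (Ω : Set (Space n)) := by
    intro x hx
    have e : f =ᶠ[𝓝 x] fun x => ∑ i, φ i x * f x :=
      eventuallyEq_of_mem (Ω.isOpen.mem_nhds hx) fun y hy => by
        have := φ.sum_eq_one (subset_closure hy)
        rw [finsum_eq_sum_of_fintype] at this
        rw [← Finset.sum_mul, this, one_mul]
    simp only
    rw [e.fderiv_eq, fderiv_fun_sum fun i _ => (hsm i).differentiable (by simp) x]
    simp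
  rw [setIntegral_congr_fun Ω.isOpen.measurableSet hsum, integral_finsetSum]
  · refine Finset.sum_eq_zero fun i _ => hloc i (htcl i i.2) _ (hsm i) (hcs i) ?_
    exact (tsupport_mul_subset_left).trans
      (((hφ i).trans inter_subset_left).trans interior_subset)
  · exact fun i _ => (integrable_fderiv_apply (hsm i) (hcs i)
      u.contDiff_ext.continuous).integrableOn

end Divergence

variable {n : ℕ} {Ω : Opens (Space n)}

/-! ### Continuity of contraction, bracket, vorticity and pairing -/

section Operations

theorem SmoothFn.eq_of_eqOn {V : Type} [NormedAddCommGroup V] [NormedSpace ℝ V]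
    {f g : SmoothFn Ω V} (h : EqOn f.ext g.ext (Ω : Set (Space n))) : f = g :=
  eq_of_apply fun x => by
    rw [← ext_apply f, ← ext_apply g]
    exact h.closure f.contDiff_ext.continuous g.contDiff_ext.continuous x.2

/-- Needed for the chain rule `IsCk.comp` with values in `SVect Ω`. -/
instance : LocallyConvexSpace ℝ (SVect Ω) := LocallyConvexSpace.induced (SVect Ω).subtype

variable (Ω) in
/-- The contraction as a bilinear map. -/
def contractₗ : VectField Ω →ₗ[ℝ] TwoTensor Ω →ₗ[ℝ] OneForm Ω :=
  SmoothFn.bil Ω (ContinuousLinearMap.id ℝ (Space n →L[ℝ] Space n →L[ℝ] ℝ)).flip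

theorem contractₗ_apply (u : VectField Ω) (w : TwoTensor Ω) :
    contractₗ Ω u w = contract Ω u w := rfl

theorem contract_ext (u : VectField Ω) (w : TwoTensor Ω) {x : Space n}
    (hx : x ∈ closure (Ω : Set (Space n))) : (contract Ω u w).ext x = w.ext x (u.ext x) :=
  SmoothFn.ext_restrict _ hx

variable (Ω) in
/-- The Lie bracket as a bilinear map. -/
def bracketₗ : VectField Ω →ₗ[ℝ] VectField Ω →ₗ[ℝ] VectField Ω :=
  let B := (SmoothFn.bil Ω (ContinuousLinearMap.id ℝ (Space n →L[ℝ] Space n))).comp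
    (SmoothFn.D Ω (Space n))
  B.flip - B

theorem bracketₗ_apply (u v : VectField Ω) : bracketₗ Ω u v = bracket Ω u v :=
  SmoothFn.eq_of_apply fun x => by
    rw [← SmoothFn.ext_apply, ← SmoothFn.ext_apply, bracket_ext u v x.2, SmoothFn.ext_apply]
    change (_ - _ : VectField Ω) x = _
    rw [sub_eq_add_neg, ← neg_one_smul ℝ, SmoothFn.add_apply, SmoothFn.smul_apply]
    simp [SmoothFn.bil_apply, SmoothFn.D_apply, SmoothFn.ext_apply, sub_eq_add_neg]

variable (Ω) in
/-- The Lie bracket on `SVect(Ω)`. -/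
def bracketS : SVect Ω →ₗ[ℝ] SVect Ω →ₗ[ℝ] SVect Ω :=
  LinearMap.mk₂ ℝ (fun u v => ⟨bracket Ω u v, bracket_mem_SVect u v⟩)
    (fun u u' v => Subtype.ext (by simp [← bracketₗ_apply]))
    (fun c u v => Subtype.ext (by simp [← bracketₗ_apply]))
    (fun u v v' => Subtype.ext (by simp [← bracketₗ_apply]))
    (fun c u v => Subtype.ext (by simp [← bracketₗ_apply]))

theorem coe_bracketS (u v : SVect Ω) : (bracketS Ω u v : VectField Ω) = bracket Ω u v := rfl

theorem bracket_jacobi (u v w : VectField Ω) :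
    bracket Ω u (bracket Ω v w) = bracket Ω (bracket Ω u v) w + bracket Ω v (bracket Ω u w) := by
  refine SmoothFn.eq_of_eqOn fun x hx => ?_
  have hcl := subset_closure (s := (Ω : Set (Space n))) hx
  -- The chosen extension of a bracket agrees with the bracket of the extensions only on the closure
  -- of Ω; near an interior point this is equality of germs, enough for iterated brackets.
  have e : ∀ u v : VectField Ω, (bracket Ω u v).ext =ᶠ[𝓝 x] VectorField.lieBracket ℝ u.ext v.ext :=
    fun u v => eventuallyEq_of_mem (Ω.isOpen.mem_nhds hx) fun y hy =>
      SmoothFn.ext_restrict _ (subset_closure hy)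
  have hle : minSmoothness ℝ 2 ≤ (∞ : ℕ∞ω) := by
    rw [minSmoothness_of_isRCLikeNormedField]
    exact WithTop.coe_le_coe.2 le_top
  have h := VectorField.leibniz_identity_lieBracket (𝕜 := ℝ) hle
    (u.contDiff_ext.contDiffAt (x := x)) (v.contDiff_ext.contDiffAt (x := x))
    (w.contDiff_ext.contDiffAt (x := x))
  rw [SmoothFn.ext_add _ _ hcl, (e u _).eq_of_nhds, (e _ w).eq_of_nhds, (e v _).eq_of_nhds,
    ((EventuallyEq.refl _ u.ext).lieBracket_vectorField (e v w)).eq_of_nhds,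
    ((e u v).lieBracket_vectorField (EventuallyEq.refl _ w.ext)).eq_of_nhds,
    ((EventuallyEq.refl _ v.ext).lieBracket_vectorField (e u w)).eq_of_nhds]
  exact h

theorem exists_cls_eq (m : SVectDual Ω) : ∃ α, cls Ω α = m := Submodule.Quotient.mk_surjective _ m

theorem vorticity_cls (α : OneForm Ω) : vorticity Ω (cls Ω α) = d₁ Ω α := rfl

theorem d₁_ext (α : OneForm Ω) {x : Space n} (hx : x ∈ closure (Ω : Set (Space n)))
    (v w : Space n) : (d₁ Ω α).ext x v w = fderiv ℝ α.ext x v w - fderiv ℝ α.ext x w v := by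
  rw [← d₁_apply Ω α ⟨x, hx⟩, ← SmoothFn.ext_apply]

variable (Ω) in
/-- The class of a one-form, as a continuous linear map. -/
def clsL : OneForm Ω →L[ℝ] SVectDual Ω where
  toLinearMap := (LinearMap.range (d₀ Ω)).mkQ
  cont := continuous_quot_mk

variable (n) in
/-- The identification of vectors and covectors. -/
def flat : Space n →L[ℝ] Space n →L[ℝ] ℝ :=
  ∑ i : Fin n, (EuclideanSpace.proj i : Space n →L[ℝ] ℝ).smulRight
    (EuclideanSpace.proj i : Space n →L[ℝ] ℝ)

theorem flat_apply_self (v : Space n) : flat n v v = ‖v‖ ^ 2 := by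
  rw [EuclideanSpace.real_norm_sq_eq]
  simp [flat, pow_two]

variable [CompactSpace (closure (Ω : Set (Space n)))]

theorem continuous_contract :
    Continuous fun p : VectField Ω × TwoTensor Ω => contractₗ Ω p.1 p.2 :=
  SmoothFn.continuous_bil _

theorem continuous_bracketS : Continuous fun p : SVect Ω × SVect Ω => bracketS Ω p.1 p.2 := by
  refine Continuous.subtype_mk ?_ _
  have hB : Continuous fun p : VectField Ω × VectField Ω =>
      SmoothFn.bil Ω (ContinuousLinearMap.id ℝ (Space n →L[ℝ] Space n))
        (SmoothFn.DL Ω (Space n) p.1) p.2 :=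
    (SmoothFn.continuous_bil (ContinuousLinearMap.id ℝ (Space n →L[ℝ] Space n))).comp
      (((SmoothFn.DL Ω (Space n)).continuous.comp continuous_fst).prodMk continuous_snd)
  have h1 : Continuous fun p : SVect Ω × SVect Ω => (p.1 : VectField Ω) :=
    continuous_subtype_val.comp continuous_fst
  have h2 : Continuous fun p : SVect Ω × SVect Ω => (p.2 : VectField Ω) :=
    continuous_subtype_val.comp continuous_snd
  exact ((hB.comp (h2.prodMk h1)).sub (hB.comp (h1.prodMk h2))).congr
    fun p => bracketₗ_apply (p.1 : VectField Ω) p.2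

theorem SmoothFn.continuous_comp {V W : Type} [NormedAddCommGroup V] [NormedSpace ℝ V]
    [NormedAddCommGroup W] [NormedSpace ℝ W] (L : V →L[ℝ] W) : Continuous (SmoothFn.comp Ω L) := by
  -- Composition with `L` is the bilinear product $(c,v)\mapsto c\,L(v)$ with the constant function
  -- 1.
  have h := (SmoothFn.continuous_bil (Ω := Ω) ((1 : ℝ →L[ℝ] ℝ).smulRight L)).comp
    ((continuous_const (y := SmoothFn.restrict Ω (fun _ => (1 : ℝ)) contDiff_const)).prodMk
      continuous_id)
  refine h.congr fun f => SmoothFn.eq_of_apply fun x => ?_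
  simp [SmoothFn.bil_apply, SmoothFn.comp_apply]

theorem continuous_d₁ : Continuous (d₁ Ω) := by
  have h : ∀ L, Continuous (SmoothFn.comp Ω L ∘ₗ SmoothFn.D Ω (Space n →L[ℝ] ℝ) :
      OneForm Ω →ₗ[ℝ] TwoTensor Ω) := fun L =>
    (SmoothFn.continuous_comp L).comp (SmoothFn.DL Ω (Space n →L[ℝ] ℝ)).continuous
  exact h _

variable (Ω) in
/-- The vorticity as a continuous linear map. -/
def vorticityL : SVectDual Ω →L[ℝ] TwoTensor Ω where
  toLinearMap := vorticity Ω
  cont := continuous_quot_lift _ continuous_d₁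

theorem vorticityL_apply (m : SVectDual Ω) : vorticityL Ω m = vorticity Ω m := rfl

variable (Ω) in
/-- The pairing as a bilinear map. -/
def pairingₗ : OneForm Ω →ₗ[ℝ] VectField Ω →ₗ[ℝ] ℝ :=
  (SmoothFn.bil Ω (ContinuousLinearMap.id ℝ (Space n →L[ℝ] ℝ))).compr₂ (SmoothFn.integralₗ Ω)

theorem pairingₗ_apply (α : OneForm Ω) (u : VectField Ω) : pairingₗ Ω α u = pairing Ω α u :=
  setIntegral_congr_fun Ω.isOpen.measurableSet fun x hx => by
    have h := SmoothFn.ext_apply (SmoothFn.bil Ω (ContinuousLinearMap.id ℝ (Space n →L[ℝ] ℝ)) α u)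
      ⟨x, subset_closure hx⟩
    rwa [SmoothFn.bil_apply, ← SmoothFn.ext_apply α, ← SmoothFn.ext_apply u] at h

theorem continuous_pairing :
    Continuous fun p : OneForm Ω × VectField Ω => pairingₗ Ω p.1 p.2 :=
  (SmoothFn.integral Ω).continuous.comp (SmoothFn.continuous_bil _)

/-- The functional on `SVect(Ω)` defined by a one-form. -/
def pairingL (α : OneForm Ω) : SVect Ω →L[ℝ] ℝ where
  toLinearMap := (pairingₗ Ω α).comp (SVect Ω).subtype
  cont := continuous_pairing.comp (continuous_const.prodMk continuous_subtype_val)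

theorem pairingL_apply (α : OneForm Ω) (u : SVect Ω) : pairingL α u = pairing Ω α u :=
  pairingₗ_apply α u

theorem integrableOn_of_continuous {f : Space n → ℝ} (hf : Continuous f) :
    IntegrableOn f (Ω : Set (Space n)) :=
  (hf.continuousOn.integrableOn_compact (isCompact_iff_compactSpace.2 ‹_›)).mono_set subset_closure

/-- The pairing separates vector fields. -/
theorem eq_zero_of_pairing_eq_zero {z : VectField Ω} (h : ∀ α, pairing Ω α z = 0) : z = 0 := by
  -- Testing against the one-form dual to `z` gives the integral of $|z|^2$.
  have h0 := h (SmoothFn.comp Ω (flat n) z)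
  have h1 : ∫ x in (Ω : Set (Space n)), ‖z.ext x‖ ^ 2 = 0 := by
    rw [← h0]
    refine setIntegral_congr_fun Ω.isOpen.measurableSet fun x hx => ?_
    simp only [SmoothFn.comp, LinearMap.coe_mk, AddHom.coe_mk]
    rw [SmoothFn.ext_restrict _ (subset_closure hx), flat_apply_self]
  have hc : Continuous fun x => ‖z.ext x‖ ^ 2 := z.contDiff_ext.continuous.norm.pow 2
  rw [setIntegral_eq_zero_iff_of_nonneg_ae (ae_of_all _ fun x => sq_nonneg _)
    (integrableOn_of_continuous hc)] at h1
  have h2 := Measure.eqOn_open_of_ae_eq h1 Ω.isOpen hc.continuousOn continuousOn_const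
  refine SmoothFn.eq_of_eqOn fun x hx => ?_
  have h3 : (0 : VectField Ω).ext x = 0 := SmoothFn.ext_apply _ ⟨x, subset_closure hx⟩
  rw [h3]
  simpa using h2 hx

end Operations

/-! ### Integral identities for the vorticity -/

section Identities

theorem pairing_contract_skew (m : SVectDual Ω) (u v : VectField Ω) :
    pairing Ω (contract Ω u (vorticity Ω m)) v = -pairing Ω (contract Ω v (vorticity Ω m)) u := by
  obtain ⟨α, rfl⟩ := exists_cls_eq m
  rw [vorticity_cls, pairing, pairing, ← integral_neg]
  refine setIntegral_congr_fun Ω.isOpen.measurableSet fun x hx => ?_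
  have hcl := subset_closure (s := (Ω : Set (Space n))) hx
  simp only [contract_ext _ _ hcl, d₁_ext α hcl]
  ring

/-- Cartan's formula for $d\alpha(u,v)$: the terms $u(\alpha(v))$ and $v(\alpha(u))$ integrate to
zero by orthogonality to gradients. -/
theorem pairing_contract_d₁ (hb : Bornology.IsBounded (Ω : Set (Space n)))
    (hs : HasSmoothBoundary Ω) (α : OneForm Ω) (u v : SVect Ω) :
    pairing Ω (contract Ω u (d₁ Ω α)) v = -pairing Ω α (bracket Ω u v) := by
  have : CompactSpace (closure (Ω : Set (Space n))) :=
    isCompact_iff_compactSpace.1 hb.isCompact_closure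
  have hα := α.contDiff_ext
  have hu := (u : VectField Ω).contDiff_ext
  have hv := (v : VectField Ω).contDiff_ext
  have h1 := setIntegral_fderiv_apply_eq_zero hb hs u.2 (hα.clm_apply hv)
  have h2 := setIntegral_fderiv_apply_eq_zero hb hs v.2 (hα.clm_apply hu)
  have i1 := integrableOn_of_continuous (Ω := Ω)
    (((hα.clm_apply hv).continuous_fderiv (by simp)).clm_apply hu.continuous)
  have i2 := integrableOn_of_continuous (Ω := Ω)
    (((hα.clm_apply hu).continuous_fderiv (by simp)).clm_apply hv.continuous)
  have i3 := integrableOn_of_continuous (Ω := Ω)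
    (hα.continuous.clm_apply (bracket Ω u v).contDiff_ext.continuous)
  have key : EqOn (fun x => (contract Ω u (d₁ Ω α)).ext x ((v : VectField Ω).ext x))
      (fun x => fderiv ℝ (fun y => α.ext y ((v : VectField Ω).ext y)) x ((u : VectField Ω).ext x) -
        fderiv ℝ (fun y => α.ext y ((u : VectField Ω).ext y)) x ((v : VectField Ω).ext x) -
        α.ext x ((bracket Ω u v).ext x)) (Ω : Set (Space n)) := by
    intro x hx
    have hcl := subset_closure (s := (Ω : Set (Space n))) hx
    have dα := hα.differentiable (by simp) x
    simp only
    rw [contract_ext _ _ hcl, d₁_ext α hcl, bracket_ext _ _ hcl,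
      fderiv_clm_apply dα (hv.differentiable (by simp) x),
      fderiv_clm_apply dα (hu.differentiable (by simp) x)]
    simp
    ring
  rw [pairing, setIntegral_congr_fun Ω.isOpen.measurableSet key]
  refine (integral_sub (i1.sub i2) i3).trans ?_
  rw [integral_sub' i1 i2, h1, h2, pairing]
  simp

theorem arnoldBracket_eq (F G : SVectDual Ω → ℝ) (m : SVectDual Ω) :
    arnoldBracket Ω F G m =
      pairing Ω (contract Ω (grad Ω F m) (vorticity Ω m)) (grad Ω G m) :=
  setIntegral_congr_fun Ω.isOpen.measurableSet fun x hx => by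
    simp only [contract_ext _ _ (subset_closure hx)]

theorem arnoldBracket_skew (F G : SVectDual Ω → ℝ) :
    arnoldBracket Ω G F = -arnoldBracket Ω F G := by
  funext m
  rw [Pi.neg_apply, arnoldBracket_eq, arnoldBracket_eq, pairing_contract_skew]

end Identities

/-! ### Gradients, the Hamiltonian structure and the Jacobi identity -/

section Gradients

variable {F G H : SVectDual Ω → ℝ} {u v : SVectDual Ω → SVect Ω}

theorem isL2Gradient_grad (h : ∃ u, IsL2Gradient Ω F u) : IsL2Gradient Ω F (grad Ω F) := by
  rw [grad, dif_pos h]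
  exact h.choose_spec

variable [CompactSpace (closure (Ω : Set (Space n)))]

/-- Two gradients have the same pairing with every one-form, and the pairing separates fields. -/
theorem IsL2Gradient.grad_eq (h : IsL2Gradient Ω F u) : grad Ω F = u := by
  have h' := isL2Gradient_grad ⟨u, h⟩
  funext m
  refine sub_eq_zero.1 (Subtype.ext (eq_zero_of_pairing_eq_zero fun α => ?_))
  have e := (h'.2 m α).unique (h.2 m α)
  rw [← pairingL_apply, ← pairingL_apply] at e
  rw [← pairingL_apply, map_sub, e, sub_self]

theorem IsL2Gradient.add (hF : IsL2Gradient Ω F u) (hG : IsL2Gradient Ω G v) :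
    IsL2Gradient Ω (F + G) (u + v) := by
  refine ⟨fun k => (hF.1 k).add (hG.1 k), fun m α => ?_⟩
  have h := ((hF.2 m α).prodMk (hG.2 m α)).clm_comp
    (ContinuousLinearMap.fst ℝ ℝ ℝ + ContinuousLinearMap.snd ℝ ℝ ℝ)
  refine HasDirDeriv.congr_deriv h ?_
  simp only [Pi.add_apply, ← pairingL_apply, map_add]
  simp

theorem IsL2Gradient.smul (c : ℝ) (hF : IsL2Gradient Ω F u) :
    IsL2Gradient Ω (c • F) (c • u) := by
  refine ⟨fun k => (hF.1 k).clm_comp (c • ContinuousLinearMap.id ℝ (SVect Ω)), fun m α => ?_⟩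
  refine HasDirDeriv.congr_deriv ((hF.2 m α).clm_comp (c • ContinuousLinearMap.id ℝ ℝ)) ?_
  simp only [Pi.smul_apply, ← pairingL_apply, map_smul]
  simp

theorem zero_mem_admissible : (0 : SVectDual Ω → ℝ) ∈ admissible Ω := by
  refine ⟨fun k => isCk_clm k (0 : SVectDual Ω →L[ℝ] ℝ), 0,
    fun k => isCk_clm k (0 : SVectDual Ω →L[ℝ] SVect Ω), fun m α => ?_⟩
  refine (hasDirDeriv_clm (0 : SVectDual Ω →L[ℝ] ℝ) m _).congr_deriv ?_
  rw [Pi.zero_apply, ← pairingL_apply, map_zero]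
  simp

theorem add_mem_admissible (hF : F ∈ admissible Ω) (hG : G ∈ admissible Ω) :
    F + G ∈ admissible Ω :=
  ⟨fun k => (hF.1 k).add (hG.1 k), _, (isL2Gradient_grad hF.2).add (isL2Gradient_grad hG.2)⟩

theorem smul_mem_admissible (c : ℝ) (hF : F ∈ admissible Ω) : c • F ∈ admissible Ω :=
  ⟨fun k => (hF.1 k).clm_comp (c • ContinuousLinearMap.id ℝ ℝ), _, (isL2Gradient_grad hF.2).smul c⟩

theorem grad_add (hF : F ∈ admissible Ω) (hG : G ∈ admissible Ω) :
    grad Ω (F + G) = grad Ω F + grad Ω G :=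
  ((isL2Gradient_grad hF.2).add (isL2Gradient_grad hG.2)).grad_eq

theorem grad_smul (c : ℝ) (hF : F ∈ admissible Ω) : grad Ω (c • F) = c • grad Ω F :=
  ((isL2Gradient_grad hF.2).smul c).grad_eq

/-- Symmetry of the Hessian of a functional with a smooth gradient. -/
theorem IsL2Gradient.hessian_symm (h : IsL2Gradient Ω F u)
    {du : SVectDual Ω × SVectDual Ω → SVect Ω} (hdu : ∀ m x, HasDirDeriv u m x (du (m, x)))
    (hc : Continuous du) (m : SVectDual Ω) (β γ : OneForm Ω) :
    pairing Ω β (du (m, cls Ω γ)) = pairing Ω γ (du (m, cls Ω β)) := by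
  have key := second_dirDeriv_symm (b := cls Ω β) (c := cls Ω γ) (F := F)
    (P := fun m => pairingL β (u m)) (Q := fun m => pairingL γ (u m))
    (H := fun m => pairingL β (du (m, cls Ω γ))) (K := fun m => pairingL γ (du (m, cls Ω β)))
    (fun m => (h.2 m β).congr_deriv (pairingL_apply β _).symm)
    (fun m => (hdu m _).clm_comp (pairingL β))
    (fun m => (h.2 m γ).congr_deriv (pairingL_apply γ _).symm)
    (fun m => (hdu m _).clm_comp (pairingL γ))
    ((pairingL β).continuous.comp (hc.comp (continuous_id.prodMk continuous_const)))
    ((pairingL γ).continuous.comp (hc.comp (continuous_id.prodMk continuous_const))) m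
  simpa only [pairingL_apply] using key

/-- The contraction of the gradient with the vorticity is smooth. -/
theorem isSmooth_contract (hu : IsSmooth u) :
    IsSmooth fun m => contractₗ Ω (u m) (vorticityL Ω m) := fun k =>
  IsCk.bilin _ continuous_contract ((hu k).clm_comp (SVect Ω).subtypeL) (isCk_clm k (vorticityL Ω))

/-- The expression for the gradient of Arnold's bracket, in terms of the gradients `u`, `v` and
their directional derivatives. -/
def bracketGradient (u v : SVectDual Ω → SVect Ω) (du dv : SVectDual Ω × SVectDual Ω → SVect Ω)
    (m : SVectDual Ω) : SVect Ω :=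
  dv (m, cls Ω (contract Ω (u m) (vorticity Ω m))) -
    du (m, cls Ω (contract Ω (v m) (vorticity Ω m))) - bracketS Ω (u m) (v m)

theorem isSmooth_bracketGradient {du dv : SVectDual Ω × SVectDual Ω → SVect Ω}
    (hu : IsSmooth u) (hv : IsSmooth v) (hdu : IsSmooth du) (hdv : IsSmooth dv) :
    IsSmooth (bracketGradient u v du dv) := by
  have h : ∀ {u : SVectDual Ω → SVect Ω} {dv : SVectDual Ω × SVectDual Ω → SVect Ω},
      IsSmooth u → IsSmooth dv →
      IsSmooth fun m => dv (m, clsL Ω (contractₗ Ω (u m) (vorticityL Ω m))) :=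
    fun hu hdv k => (hdv k).comp ((isCk_clm k (ContinuousLinearMap.id ℝ (SVectDual Ω))).prodMk
      ((isSmooth_contract hu k).clm_comp (clsL Ω)))
  exact fun k => ((h hu hdv k).sub (h hv hdu k)).sub
    (IsCk.bilin (bracketS Ω) continuous_bracketS (hu k) (hv k))

theorem isSmooth_arnoldBracket (hF : F ∈ admissible Ω) (hG : G ∈ admissible Ω) :
    IsSmooth (arnoldBracket Ω F G) := by
  intro k
  have h := IsCk.bilin (pairingₗ Ω) continuous_pairing
    (isSmooth_contract (isL2Gradient_grad hF.2).1 k)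
    (((isL2Gradient_grad hG.2).1 k).clm_comp (SVect Ω).subtypeL)
  convert h using 1
  funext m
  rw [arnoldBracket_eq, pairingₗ_apply]
  rfl

/-- The product rule gives three terms. Varying ω yields the Lie bracket term; in the other two,
Hessian symmetry exchanges $\beta$ with $i_{\delta F}\omega$ or $i_{\delta G}\omega$, and skewness
of ω accounts for the minus sign of the $\delta F$ term. -/
theorem isL2Gradient_arnoldBracket (hb : Bornology.IsBounded (Ω : Set (Space n)))
    (hs : HasSmoothBoundary Ω) (hF : F ∈ admissible Ω) (hG : G ∈ admissible Ω)
    {dF dG : SVectDual Ω × SVectDual Ω → SVect Ω}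
    (hdF : ∀ m x, HasDirDeriv (grad Ω F) m x (dF (m, x))) (hsF : IsSmooth dF)
    (hdG : ∀ m x, HasDirDeriv (grad Ω G) m x (dG (m, x))) (hsG : IsSmooth dG) :
    IsL2Gradient Ω (arnoldBracket Ω F G) (bracketGradient (grad Ω F) (grad Ω G) dF dG) := by
  have gF := isL2Gradient_grad hF.2
  have gG := isL2Gradient_grad hG.2
  refine ⟨isSmooth_bracketGradient gF.1 gG.1 hsF hsG, fun m β => ?_⟩
  have h1 := HasDirDeriv.bilin (contractₗ Ω) continuous_contract (vorticityL Ω).continuous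
    ((hdF m (cls Ω β)).clm_comp (SVect Ω).subtypeL) (hasDirDeriv_clm (vorticityL Ω) m (cls Ω β))
  have h2 := HasDirDeriv.bilin (pairingₗ Ω) continuous_pairing
    ((SVect Ω).subtypeL.continuous.comp (gG.1 0).continuous) h1
    ((hdG m (cls Ω β)).clm_comp (SVect Ω).subtypeL)
  have e : arnoldBracket Ω F G = fun m => pairingₗ Ω
      (contractₗ Ω ((SVect Ω).subtypeL (grad Ω F m)) (vorticityL Ω m))
      ((SVect Ω).subtypeL (grad Ω G m)) := by
    funext m
    rw [arnoldBracket_eq, pairingₗ_apply]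
    rfl
  rw [e]
  refine HasDirDeriv.congr_deriv h2 ?_
  simp only [map_add, LinearMap.add_apply, pairingₗ_apply, contractₗ_apply, vorticityL_apply,
    vorticity_cls, Submodule.subtypeL_apply, bracketGradient, Function.comp_apply]
  rw [pairing_contract_d₁ hb hs, pairing_contract_skew,
    gF.hessian_symm hdF (hsF 0).continuous, gG.hessian_symm hdG (hsG 0).continuous,
    ← pairingL_apply β (_ - _ - _), map_sub, map_sub, pairingL_apply, pairingL_apply,
    pairingL_apply, coe_bracketS]
  ring

theorem arnoldBracket_mem_admissible (hb : Bornology.IsBounded (Ω : Set (Space n)))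
    (hs : HasSmoothBoundary Ω) (hF : F ∈ admissible Ω) (hG : G ∈ admissible Ω) :
    arnoldBracket Ω F G ∈ admissible Ω := by
  obtain ⟨dF, hdF, hsF⟩ := (isL2Gradient_grad hF.2).1.exists_dirDeriv
  obtain ⟨dG, hdG, hsG⟩ := (isL2Gradient_grad hG.2).1.exists_dirDeriv
  exact ⟨isSmooth_arnoldBracket hF hG, _,
    isL2Gradient_arnoldBracket hb hs hF hG hdF hsF hdG hsG⟩

theorem arnoldBracket_add_right (F : SVectDual Ω → ℝ) (hG : G ∈ admissible Ω)
    (hH : H ∈ admissible Ω) :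
    arnoldBracket Ω F (G + H) = arnoldBracket Ω F G + arnoldBracket Ω F H := by
  funext m
  simp only [Pi.add_apply, arnoldBracket_eq, grad_add hG hH, ← pairingL_apply, map_add]

theorem arnoldBracket_smul_right (c : ℝ) (F : SVectDual Ω → ℝ) (hG : G ∈ admissible Ω) :
    arnoldBracket Ω F (c • G) = c • arnoldBracket Ω F G := by
  funext m
  simp only [Pi.smul_apply, arnoldBracket_eq, grad_smul c hG, ← pairingL_apply, map_smul]

/-- The double bracket in terms of Hessians and Lie brackets. -/
theorem arnoldBracket_arnoldBracket (hb : Bornology.IsBounded (Ω : Set (Space n)))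
    (hs : HasSmoothBoundary Ω) (hF : F ∈ admissible Ω) (hG : G ∈ admissible Ω)
    {dF dG : SVectDual Ω × SVectDual Ω → SVect Ω}
    (hdF : ∀ m x, HasDirDeriv (grad Ω F) m x (dF (m, x))) (hsF : IsSmooth dF)
    (hdG : ∀ m x, HasDirDeriv (grad Ω G) m x (dG (m, x))) (hsG : IsSmooth dG) (α : OneForm Ω) :
    arnoldBracket Ω (arnoldBracket Ω F G) H (cls Ω α) =
      pairing Ω (contract Ω (grad Ω H (cls Ω α)) (d₁ Ω α))
        (dF (cls Ω α, cls Ω (contract Ω (grad Ω G (cls Ω α)) (d₁ Ω α)))) -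
      pairing Ω (contract Ω (grad Ω H (cls Ω α)) (d₁ Ω α))
        (dG (cls Ω α, cls Ω (contract Ω (grad Ω F (cls Ω α)) (d₁ Ω α)))) -
      pairingL α (bracketS Ω (grad Ω H (cls Ω α))
        (bracketS Ω (grad Ω F (cls Ω α)) (grad Ω G (cls Ω α)))) := by
  have h := pairing_contract_d₁ hb hs α (grad Ω H (cls Ω α))
    (bracketS Ω (grad Ω F (cls Ω α)) (grad Ω G (cls Ω α)))
  rw [arnoldBracket_eq, pairing_contract_skew,
    (isL2Gradient_arnoldBracket hb hs hF hG hdF hsF hdG hsG).grad_eq, bracketGradient,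
    ← pairingL_apply _ (_ - _ - _), map_sub, map_sub, pairingL_apply, pairingL_apply,
    pairingL_apply, vorticity_cls, h, pairingL_apply, coe_bracketS _ (bracketS _ _ _)]
  ring

theorem arnoldBracket_jacobi (hb : Bornology.IsBounded (Ω : Set (Space n)))
    (hs : HasSmoothBoundary Ω) (hF : F ∈ admissible Ω) (hG : G ∈ admissible Ω)
    (hH : H ∈ admissible Ω) :
    arnoldBracket Ω (arnoldBracket Ω F G) H + arnoldBracket Ω (arnoldBracket Ω G H) F +
      arnoldBracket Ω (arnoldBracket Ω H F) G = 0 := by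
  obtain ⟨dF, hdF, hsF⟩ := (isL2Gradient_grad hF.2).1.exists_dirDeriv
  obtain ⟨dG, hdG, hsG⟩ := (isL2Gradient_grad hG.2).1.exists_dirDeriv
  obtain ⟨dH, hdH, hsH⟩ := (isL2Gradient_grad hH.2).1.exists_dirDeriv
  funext m
  obtain ⟨α, rfl⟩ := exists_cls_eq m
  simp only [Pi.add_apply, Pi.zero_apply]
  rw [arnoldBracket_arnoldBracket hb hs hF hG hdF hsF hdG hsG,
    arnoldBracket_arnoldBracket hb hs hG hH hdG hsG hdH hsH,
    arnoldBracket_arnoldBracket hb hs hH hF hdH hsH hdF hsF]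
  have sF := (isL2Gradient_grad hF.2).hessian_symm hdF (hsF 0).continuous (cls Ω α)
  have sG := (isL2Gradient_grad hG.2).hessian_symm hdG (hsG 0).continuous (cls Ω α)
  have sH := (isL2Gradient_grad hH.2).hessian_symm hdH (hsH 0).continuous (cls Ω α)
  -- The Leibniz form of the Jacobi identity, turned into the cyclic sum by skewness.
  have hj : ∀ u v w : SVect Ω, bracketS Ω w (bracketS Ω u v) + bracketS Ω u (bracketS Ω v w) +
      bracketS Ω v (bracketS Ω w u) = 0 := by
    intro u v w
    have skew : ∀ u v : VectField Ω, bracket Ω u v = -bracket Ω v u := fun u v => by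
      rw [← bracketₗ_apply, ← bracketₗ_apply]
      simp [bracketₗ]
    refine Subtype.ext ?_
    simp only [Submodule.coe_add, coe_bracketS, Submodule.coe_zero]
    rw [bracket_jacobi (u : VectField Ω) v w, skew w (bracket Ω u v), skew (w : VectField Ω) u,
      ← bracketₗ_apply (v : VectField Ω) (-_), map_neg, bracketₗ_apply]
    abel
  have hj' := congrArg (pairingL α) (hj (grad Ω F (cls Ω α)) (grad Ω G (cls Ω α))
    (grad Ω H (cls Ω α)))
  rw [map_add, map_add, map_zero] at hj'
  -- The six Hessian terms of the cyclic sum form three pairs with opposite signs, one pair for each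
  -- functional.
  have e1 := sF (contract Ω (grad Ω H (cls Ω α)) (d₁ Ω α))
    (contract Ω (grad Ω G (cls Ω α)) (d₁ Ω α))
  have e2 := sG (contract Ω (grad Ω F (cls Ω α)) (d₁ Ω α))
    (contract Ω (grad Ω H (cls Ω α)) (d₁ Ω α))
  have e3 := sH (contract Ω (grad Ω G (cls Ω α)) (d₁ Ω α))
    (contract Ω (grad Ω F (cls Ω α)) (d₁ Ω α))
  linarith

theorem isHamiltonianStructure_arnoldBracket (hb : Bornology.IsBounded (Ω : Set (Space n)))
    (hs : HasSmoothBoundary Ω) :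
    IsHamiltonianStructure (admissible Ω) (arnoldBracket Ω) where
  zero_mem := zero_mem_admissible
  add_mem _ hF _ hG := add_mem_admissible hF hG
  smul_mem c _ hF := smul_mem_admissible c hF
  add_left F hF G hG H _ := by
    rw [arnoldBracket_skew H, arnoldBracket_add_right H hF hG, arnoldBracket_skew H F,
      arnoldBracket_skew H G, neg_add]
  smul_left c F hF G _ := by
    rw [arnoldBracket_skew G, arnoldBracket_smul_right c G hF, arnoldBracket_skew G F, smul_neg]
  add_right F _ _ hG _ hH := arnoldBracket_add_right F hG hH
  smul_right c F _ _ hG := arnoldBracket_smul_right c F hG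
  closed _ hF _ hG := arnoldBracket_mem_admissible hb hs hF hG
  skew F _ G _ := arnoldBracket_skew F G
  jacobi _ hF _ hG _ hH := arnoldBracket_jacobi hb hs hF hG hH

end Gradients

end ArnoldBracket

end

open ArnoldBracket
theorem mainTheorem2 (n : ℕ) (hn : n = 2 ∨ n = 3) (Ω : TopologicalSpace.Opens (Space n))
    (hΩ : IsConnected (Ω : Set (Space n))) (hb : Bornology.IsBounded (Ω : Set (Space n)))
    (hs : HasSmoothBoundary Ω) :
    (∀ F u, IsL2Gradient Ω F u → grad Ω F = u) ∧
    (∀ F ∈ admissible Ω, ∀ G ∈ admissible Ω, ∀ α : OneForm Ω,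
      arnoldBracket Ω F G (cls Ω α) =
        - pairing Ω α (bracket Ω (grad Ω F (cls Ω α)) (grad Ω G (cls Ω α)))) ∧
    IsHamiltonianStructure (admissible Ω) (arnoldBracket Ω) ∧
    (∀ F ∈ admissible Ω, ∀ G ∈ admissible Ω, ∃ w : SVectDual Ω → SVect Ω,
      IsL2Gradient Ω (arnoldBracket Ω F G) w ∧
      ∀ m : SVectDual Ω, ∃ A B : SVect Ω,
        HasDirDeriv (grad Ω G) m (cls Ω (contract Ω (grad Ω F m) (vorticity Ω m))) A ∧
        HasDirDeriv (grad Ω F) m (cls Ω (contract Ω (grad Ω G m) (vorticity Ω m))) B ∧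
        (w m : VectField Ω) =
          (A : VectField Ω) - (B : VectField Ω) - bracket Ω (grad Ω F m) (grad Ω G m)) := by
  have : CompactSpace (closure (Ω : Set (Space n))) :=
    isCompact_iff_compactSpace.1 hb.isCompact_closure
  refine ⟨fun F u h => h.grad_eq, fun F _ G _ α => ?_,
    isHamiltonianStructure_arnoldBracket hb hs, fun F hF G hG => ?_⟩
  · rw [arnoldBracket_eq, vorticity_cls, pairing_contract_d₁ hb hs]
  · obtain ⟨dF, hdF, hsF⟩ := (isL2Gradient_grad hF.2).1.exists_dirDeriv
    obtain ⟨dG, hdG, hsG⟩ := (isL2Gradient_grad hG.2).1.exists_dirDeriv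
    exact ⟨_, isL2Gradient_arnoldBracket hb hs hF hG hdF hsF hdG hsG, fun m =>
      ⟨_, _, hdG m _, hdF m _, rfl⟩⟩
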